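/- Let $S$ be a countable set of vertices (a countable graph), let $P$ be a transition kernel on $S$ (with $P(v,v)>0$ allowed), and let $\eta_0,\gamma_0:S\to\{0,1,2,\dots\}$ with $\gamma_0\le\eta_0$ and $\sum_{v\in S}\gamma_0(v)<\infty$. *ARW.* Let $\lambda\in(0,\infty]$. Consider activated random walks on $S$ started from $\eta_0(v)$ particles at each vertex $v$, all active. Each active particle hops at rate one, from its position $v$ to a vertex $y$ with probability $P(v,y)$, independently of the other particles; sleeping particles do not move. If $\lambda<\infty$, an active particle that is alone at its vertex falls asleep at rate $\lambda$ and stays asleep until a particle hops to its vertex, which makes it active again; if $\lambda=\infty$, a particle is sleeping if and only if it is alone at its vertex. Formally, on a filtered probability space, the counting process of the hops from $v$ to $y$ has stochastic intensity $a_v(t)P(v,y)$, where $a_v(t)$ is the number of active particles at $v$ at time $t$, and, for $\lambda<\infty$, the counting process of the times at which a particle at $v$ falls asleep has stochastic intensity $\lambda$ while $v$ holds exactly one particle and it is active, and $0$ otherwise; almost surely no two of these events are simultaneous. It is assumed that the process exists and that almost surely only finitely many events occur at any given vertex in finite time. Let $\mathbb P^{\eta}$ be its law, and let $M(x)$ be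 the number of distinct times at which a particle hops to $x$. *MSIA.* Fix any total ordering of $S$. Multiple source internal aggregation starts with $\gamma_0(v)$ explorers at each vertex $v$. As long as some vertex holds more than one explorer, one explorer at the first such vertex walks according to $P$ until it reaches a vertex with no other explorer, where it stays forever; then the next explorer walks in the same way, and so on, one at a time. (A walk may last forever, in which case no further explorer walks.) Let $\mathcal P^{\gamma}$ be the law of this process, and let $V(x)$ be the total number of hops of explorers to $x$. Then for every integer $r\ge 0$ and every $x\in S$, $$\mathcal P^{\gamma}[V(x)\ge r]\le\mathbb P^{\eta}[M(x)\ge r],$$ and the same holds when the initial occupants of $x$ are counted as visitors as well: $$\mathcal P^{\gamma}[\gamma_0(x)+V(x)\ge r]\le\mathbb P^{\eta}[\eta_0(x)+M(x)\ge r].$$ In particular this holds for every sleep rate $\lambda\in(0,\infty]$. -/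

import Mathlib

open MeasureTheory ProbabilityTheory
open scoped ENNReal NNReal

noncomputable section

namespace ActivatedWalk

/-! ### Multiple source internal aggregation (MSIA) -/

/-- A state of the MSIA: `occ v` is the number of explorers at `v` (the walking one included), and
`last` is the vertex to which an explorer hopped in the last step (`none` at the start, and once
the process has ended). -/
@[ext]
structure MSIAState (S : Type*) where
  occ : S →₀ ℕ
  last : Option S

instance {S : Type*} : MeasurableSpace (MSIAState S) := ⊤

instance {S : Type*} : DiscreteMeasurableSpace (MSIAState S) := ⟨fun _ => trivial⟩

instance {S : Type*} [Countable S] : Countable (MSIAState S) :=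
  Function.Injective.countable (f := fun s : MSIAState S => (s.occ, s.last)) fun _ _ h =>
    MSIAState.ext (congrArg Prod.fst h) (congrArg Prod.snd h)

/-- The first vertex, in the given ordering, that holds more than one explorer, if there is one. -/
def firstCrowded {S : Type*} [LinearOrder S] (occ : S →₀ ℕ) : Option S :=
  if h : (occ.support.filter fun v => 2 ≤ occ v).Nonempty then
    some ((occ.support.filter fun v => 2 ≤ occ v).min' h)
  else none

/-- The vertex from which an explorer makes the next hop. An explorer that has just hopped to an
occupied vertex (which now holds at least two) walks on; one that has just hopped to an
unoccupied vertex stays there forever, and the next explorer starts from the first vertex that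
holds more than one. The process ends when there is no such vertex. -/
def nextHopFrom {S : Type*} [LinearOrder S] (s : MSIAState S) : Option S :=
  match s.last with
  | some u => if 2 ≤ s.occ u then some u else firstCrowded s.occ
  | none => firstCrowded s.occ

/-- One step of the MSIA with kernel `P`: a single hop of one explorer. -/
def msiaStep {S : Type*} [LinearOrder S] (P : S → PMF S) (s : MSIAState S) : PMF (MSIAState S) :=
  match nextHopFrom s with
  | some v => (P v).map fun y => ⟨s.occ - Finsupp.single v 1 + Finsupp.single y 1, some y⟩
  | none => PMF.pure ⟨s.occ, none⟩

/-- The step of the MSIA as a Markov kernel, depending on the past only through the last state. -/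
def msiaKernel {S : Type*} [Countable S] [LinearOrder S] (P : S → PMF S) (n : ℕ) :
    Kernel ((i : Finset.Iic n) → (fun _ : ℕ => MSIAState S) i) (MSIAState S) :=
  Kernel.ofFunOfCountable fun h => (msiaStep P (h ⟨n, Finset.mem_Iic.2 le_rfl⟩)).toMeasure

instance {S : Type*} [Countable S] [LinearOrder S] (P : S → PMF S) (n : ℕ) :
    IsMarkovKernel (msiaKernel P n) :=
  ⟨fun h => PMF.toMeasure.isProbabilityMeasure
    (msiaStep P (h ⟨n, Finset.mem_Iic.2 le_rfl⟩))⟩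

/-- The law, on the space of trajectories, of the MSIA with kernel `P` and initial occupation
`γ₀`. -/
def msiaLaw {S : Type*} [Countable S] [LinearOrder S] (P : S → PMF S) (γ₀ : S →₀ ℕ) :
    Measure (ℕ → MSIAState S) :=
  Kernel.trajMeasure (X := fun _ => MSIAState S) (Measure.dirac ⟨γ₀, none⟩) (msiaKernel P)

/-- The number of times an explorer hops to `x` along a trajectory of the MSIA. -/
def explorerVisits {S : Type*} (Y : ℕ → MSIAState S) (x : S) : ℕ∞ :=
  {n | (Y n).last = some x}.encard

/-! ### Activated random walks (ARW) -/

/-- The elementary events of the ARW: a particle hops from `x` to `y` (`x = y` is allowed), and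
the particle that is alone at `x` falls asleep. -/
inductive Event (S : Type*) where
  | hop (x y : S) : Event S
  | sleep (x : S) : Event S

/-- A realization of the ARW is recorded by the set of times at which each event occurs; these are
the times at which a particle hops to `x`. -/
def arrivals {S : Type*} (e : Event S → Set ℝ≥0) (x : S) : Set ℝ≥0 := ⋃ y, e (.hop y x)

/-- The times at which a particle hops from `x`. -/
def departures {S : Type*} (e : Event S → Set ℝ≥0) (x : S) : Set ℝ≥0 := ⋃ y, e (.hop x y)

/-- The number of particles, active or sleeping, at `x` at time `t`. (For the ARW almost surely
the truncated subtraction never truncates: there is no hop from an empty vertex.) -/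
def particles {S : Type*} (η₀ : S → ℕ) (e : Event S → Set ℝ≥0) (x : S) (t : ℝ≥0) : ℕ :=
  η₀ x + (arrivals e x ∩ Set.Iic t).ncard - (departures e x ∩ Set.Iic t).ncard

/-- The particle at `x` has fallen asleep, and no particle has hopped to `x` since. -/
def FellAsleep {S : Type*} (e : Event S → Set ℝ≥0) (x : S) (t : ℝ≥0) : Prop :=
  ∃ s ∈ e (.sleep x), s ≤ t ∧ Disjoint (arrivals e x) (Set.Ioc s t)

open Classical in
/-- The number of active particles at `x` at time `t`. For infinite sleep rate a particle is
sleeping if and only if it is alone. -/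
def activeParticles {S : Type*} (η₀ : S → ℕ) (lam : ℝ≥0∞) (e : Event S → Set ℝ≥0) (x : S)
    (t : ℝ≥0) : ℕ :=
  if FellAsleep e x t ∨ (lam = ∞ ∧ particles η₀ e x t = 1) then 0 else particles η₀ e x t

/-- The rate of an event at time `t`, given the realization up to time `t`. Each active particle
hops at rate one according to `P`; an active particle that is alone falls asleep at rate `lam`.
(For `lam = ∞` the number of active particles at a vertex is never `1`.) -/
def rate {S : Type*} (P : S → PMF S) (η₀ : S → ℕ) (lam : ℝ≥0∞) (e : Event S → Set ℝ≥0)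
    (t : ℝ≥0) : Event S → ℝ≥0∞
  | .hop x y => activeParticles η₀ lam e x t * P x y
  | .sleep x => if activeParticles η₀ lam e x t = 1 then lam else 0

/-- The random point sets `ev k`, `k : Event S`, on the filtered probability space `(Ω, 𝓕, μ)`
are an ARW with kernel `P`, initial occupation `η₀` (all particles initially active) and sleep
rate `lam`. -/
structure IsARW {S Ω : Type*} [MeasurableSpace Ω] (P : S → PMF S) (η₀ : S → ℕ) (lam : ℝ≥0∞)
    (μ : Measure Ω) (𝓕 : Filtration ℝ≥0 ‹MeasurableSpace Ω›) (ev : Event S → Ω → Set ℝ≥0) :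
    Prop where
  /-- The process that counts the occurrences of each event is adapted. -/
  adapted : ∀ (k : Event S) (t : ℝ≥0) (n : ℕ),
    MeasurableSet[𝓕 t] {ω | (n : ℕ∞) ≤ (ev k ω ∩ Set.Iic t).encard}
  /-- Almost surely only finitely many events happen at any vertex in finite time. -/
  locally_finite : ∀ᵐ ω ∂μ, ∀ (x : S) (t : ℝ≥0),
    ((arrivals (ev · ω) x ∪ departures (ev · ω) x ∪ ev (.sleep x) ω) ∩ Set.Iic t).Finite
  /-- Almost surely no two events happen at the same time. -/
  no_simultaneous : ∀ᵐ ω ∂μ, Pairwise fun k l : Event S => Disjoint (ev k ω) (ev l ω)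
  /-- Each event `k` has stochastic intensity `rate k` with respect to `𝓕`:
  `E ∫ C dN_k = E ∫ C(t) rate_k(t) dt` for every non-negative predictable process `C`, where
  `N_k` is the counting process of `k`. -/
  intensity : ∀ (k : Event S) (C : ℝ≥0 → Ω → ℝ≥0∞),
    Measurable[𝓕.predictable] (Function.uncurry C) →
    ∫⁻ ω, (∑' t : ev k ω, C t ω) ∂μ =
      ∫⁻ ω, (∫⁻ t in Set.Ici (0 : ℝ),
        C t.toNNReal ω * rate P η₀ lam (ev · ω) t.toNNReal k) ∂μ

/-- The number of distinct times at which a particle, which is then active, hops to `x`. -/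
def particleVisits {S : Type*} (e : Event S → Set ℝ≥0) (x : S) : ℕ∞ := (arrivals e x).encard

end ActivatedWalk

end

noncomputable section

namespace ActivatedWalk

open Set

/-! ### Measurability of counts and of sums over random point sets -/

section Measurability

/-! The two processes are compared through the hops from each vertex, numbered in order of time,
without constructing a coupling. A realization `e` of the ARW reveals where hop number `i` from `v`
goes, provided that this hop ever happens. For a finite run `Z` of the MSIA, `runWeight` is the
conditional probability given `e` that the MSIA follows `Z`: each hop used by `Z` contributes 0 or 1
if it is revealed in `e`, and its a priori probability under `P` otherwise.

The mean of this weight is the MSIA probability of `Z` (`IsARW.lintegral_runWeight`). Indeed the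
product of the factors, as a function of time, changes only when one of its hops happens. As the hop
from `v` to `y` has intensity `P v y` times a rate that does not depend on `y`, each such change has
mean zero (`IsARW.lintegral_prod_hopFactor`).

By the least action principle (`IsRun.follows`), a run of nonzero weight almost surely uses only
hops that happen. Otherwise, consider the first hop it uses that does not happen, from `v` say. The
earlier hops of the run all happen, so from some time on `v` holds at least two particles, none of
which ever hops. This has probability zero, since those particles are active
(`IsARW.ae_not_blocked`); the sleep rate plays no role here.

A run of length `n` that uses only hops of `e` is determined by `e` (`IsRun.eq_of_follows`), and its
hops to `x` happen at distinct times in `e` (`IsRun.exists_arrivals`). Hence the weights of all runs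
with at least `k` hops to `x` add up to at most the indicator of at least `k` arrivals at `x`.
Integration and `n → ∞` give the claim. -/

theorem measurable_toENNReal_of_le {α : Type*} {m : MeasurableSpace α} {f : α → ℕ∞}
    (hf : ∀ n : ℕ, MeasurableSet {a | (n : ℕ∞) ≤ f a}) :
    Measurable fun a => (f a : ℝ≥0∞) := by
  refine measurable_of_Ioi fun c => ?_
  have : (fun a => (f a : ℝ≥0∞)) ⁻¹' Ioi c =
      ⋃ (n : ℕ) (_ : c < (n : ℝ≥0∞)), {a | (n : ℕ∞) ≤ f a} := by
    ext a
    simp only [mem_preimage, mem_Ioi, mem_iUnion, mem_ofPred_eq, exists_prop]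
    constructor
    · intro h
      induction hfa : f a with
      | top =>
        rw [hfa] at h
        obtain ⟨n, hn⟩ := ENNReal.exists_nat_gt (ne_top_of_lt h)
        exact ⟨n, hn, le_top⟩
      | coe k => exact ⟨k, by simpa [hfa] using h, le_rfl⟩
    · rintro ⟨n, hn, hle⟩
      exact hn.trans_le (by exact_mod_cast ENat.toENNReal_le.2 hle)
  rw [this]
  exact MeasurableSet.iUnion fun n => MeasurableSet.iUnion fun _ => hf n

/-- The points of `E` up to time `q`, if there are finitely many of them; otherwise none. -/
def finiteUpTo (E : Set ℝ≥0) (q : ℝ≥0) : Set ℝ≥0 := {t | t ∈ E ∧ t ≤ q ∧ (E ∩ Iic q).Finite}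

theorem finiteUpTo_subset (E : Set ℝ≥0) (q : ℝ≥0) : finiteUpTo E q ⊆ E := fun _ h => h.1

/-- The truncation makes this true in every realization, not only almost surely, so that counts can
be subtracted in `ℝ≥0∞`. -/
theorem finite_finiteUpTo (E : Set ℝ≥0) (q : ℝ≥0) : (finiteUpTo E q).Finite := by
  by_cases h : (E ∩ Iic q).Finite
  · exact h.subset fun t ht => ⟨ht.1, ht.2.1⟩
  · convert Set.finite_empty
    ext t
    simp [finiteUpTo, h]

variable {Ω : Type*} {m : MeasurableSpace Ω} {𝓕 : Filtration ℝ≥0 m} {E : Ω → Set ℝ≥0}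

theorem measurable_encard_finiteUpTo_inter
    (hE : ∀ (t : ℝ≥0) (n : ℕ), MeasurableSet[𝓕 t] {ω | (n : ℕ∞) ≤ (E ω ∩ Iic t).encard})
    {i q : ℝ≥0} (hi : i ≤ q) :
    Measurable[𝓕 q] fun ω => ((finiteUpTo (E ω) q ∩ Iic i).encard : ℝ≥0∞) := by
  have hfin : MeasurableSet[𝓕 q] {ω | (E ω ∩ Iic q).Finite} := by
    have : {ω | (E ω ∩ Iic q).Finite} =
        ⋃ n : ℕ, {ω | (n : ℕ∞) ≤ (E ω ∩ Iic q).encard}ᶜ := by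
      ext ω
      simp only [mem_ofPred_eq, mem_iUnion, mem_compl_iff, not_le]
      constructor
      · intro h
        refine ⟨(E ω ∩ Iic q).ncard + 1, ?_⟩
        rw [← h.cast_ncard_eq]
        exact_mod_cast Nat.lt_succ_self _
      · rintro ⟨n, hn⟩
        exact Set.encard_lt_top_iff.1 (hn.trans_le le_top)
    rw [this]
    exact MeasurableSet.iUnion fun n => (hE q n).compl
  have h1 : Measurable[𝓕 q] fun ω => ((E ω ∩ Iic i).encard : ℝ≥0∞) :=
    measurable_toENNReal_of_le fun n => 𝓕.mono hi _ (hE i n)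
  have : (fun ω => ((finiteUpTo (E ω) q ∩ Iic i).encard : ℝ≥0∞)) =
      {ω | (E ω ∩ Iic q).Finite}.indicator fun ω => ((E ω ∩ Iic i).encard : ℝ≥0∞) := by
    ext ω
    by_cases h : (E ω ∩ Iic q).Finite
    · rw [indicator_of_mem (by exact h)]
      congr 2
      ext t
      simp only [finiteUpTo, mem_inter_iff, mem_ofPred_eq, mem_Iic]
      exact ⟨fun H => ⟨H.1.1, H.2⟩, fun H => ⟨⟨H.1, H.2.trans hi, h⟩, H.2⟩⟩
    · rw [indicator_of_notMem (by exact h)]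
      have : finiteUpTo (E ω) q = ∅ := by ext t; simp [finiteUpTo, h]
      simp [this]
  rw [this]
  exact h1.indicator hfin

theorem isPiSystem_predictable_generator :
    IsPiSystem ({s : Set (ℝ≥0 × Ω) | ∃ A, MeasurableSet[𝓕 ⊥] A ∧ s = {⊥} ×ˢ A} ∪
    {s | ∃ i A, MeasurableSet[𝓕 i] A ∧ s = Set.Ioi i ×ˢ A}) := by
  rintro _ (⟨A, hA, rfl⟩ | ⟨i, A, hA, rfl⟩) _ (⟨B, hB, rfl⟩ | ⟨j, B, hB, rfl⟩) -
  · exact Or.inl ⟨A ∩ B, hA.inter hB, by rw [prod_inter_prod, inter_self]⟩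
  · refine Or.inl ⟨∅, @MeasurableSet.empty _ (𝓕 ⊥), ?_⟩
    ext ⟨t, ω⟩
    simp only [bot_eq_zero, mem_inter_iff, mem_prod, mem_singleton_iff, mem_Ioi, prod_empty,
      mem_empty_iff_false, iff_false]
    rintro ⟨⟨rfl, -⟩, h, -⟩
    exact not_lt_bot h
  · refine Or.inl ⟨∅, @MeasurableSet.empty _ (𝓕 ⊥), ?_⟩
    ext ⟨t, ω⟩
    simp only [bot_eq_zero, mem_inter_iff, mem_prod, mem_singleton_iff, mem_Ioi, prod_empty,
      mem_empty_iff_false, iff_false]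
    rintro ⟨⟨h, -⟩, rfl, -⟩
    exact not_lt_bot h
  · refine Or.inr ⟨max i j, A ∩ B, (𝓕.mono (le_max_left _ _) _ hA).inter
      (𝓕.mono (le_max_right _ _) _ hB), ?_⟩
    rw [prod_inter_prod, Ioi_inter_Ioi]

/-- Induction over the predictable σ-algebra: on generating rectangles the sum is a count restricted
to an event, and complements amount to subtraction from a finite total count. -/
theorem measurable_tsum_indicator_finiteUpTo
    (hE : ∀ (t : ℝ≥0) (n : ℕ), MeasurableSet[𝓕 t] {ω | (n : ℕ∞) ≤ (E ω ∩ Iic t).encard})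
    (q : ℝ≥0) {B : Set (ℝ≥0 × Ω)} (hB : MeasurableSet[𝓕.predictable] B) :
    Measurable[𝓕 q] fun ω =>
      ∑' t : finiteUpTo (E ω) q, B.indicator (fun _ => (1 : ℝ≥0∞)) (t, ω) := by
  have hcount : Measurable[𝓕 q] fun ω => ((finiteUpTo (E ω) q).encard : ℝ≥0∞) := by
    convert measurable_encard_finiteUpTo_inter hE (le_refl q) using 5 with ω
    ext t
    simp only [finiteUpTo, mem_inter_iff, mem_ofPred_eq, mem_Iic]
    tauto
  have hrect : ∀ (T : Set ℝ≥0) (A : Set Ω) (ω : Ω),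
      ∑' t : finiteUpTo (E ω) q, (T ×ˢ A).indicator (fun _ => (1 : ℝ≥0∞)) (t, ω) =
        A.indicator (fun ω => ((finiteUpTo (E ω) q ∩ T).encard : ℝ≥0∞)) ω := by
    intro T A ω
    by_cases hω : ω ∈ A
    · rw [indicator_of_mem hω, ← ENNReal.tsum_set_one,
        tsum_subtype (finiteUpTo (E ω) q ∩ T) (fun _ => (1 : ℝ≥0∞)),
        ← indicator_indicator]
      rw [← tsum_subtype (finiteUpTo (E ω) q)]
      refine tsum_congr fun t => ?_
      by_cases ht : (t : ℝ≥0) ∈ T <;> simp [ht, hω]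
    · simp [hω]
  induction B, hB using MeasurableSpace.induction_on_inter (m := 𝓕.predictable) rfl
    isPiSystem_predictable_generator with
  | empty => simp
  | basic s hs =>
    rcases hs with ⟨A, hA, rfl⟩ | ⟨i, A, hA, rfl⟩
    · simp_rw [hrect]
      refine Measurable.indicator ?_ (𝓕.mono bot_le _ hA)
      have := measurable_encard_finiteUpTo_inter hE (bot_le : ⊥ ≤ q)
      have hIic : Iic (⊥ : ℝ≥0) = {⊥} := Iic_bot
      rwa [hIic] at this
    · simp_rw [hrect]
      rcases le_or_gt i q with hi | hi
      · refine Measurable.indicator ?_ (𝓕.mono hi _ hA)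
        have : (fun ω => ((finiteUpTo (E ω) q ∩ Ioi i).encard : ℝ≥0∞)) = fun ω =>
            ((finiteUpTo (E ω) q).encard : ℝ≥0∞) -
              ((finiteUpTo (E ω) q ∩ Iic i).encard : ℝ≥0∞) := by
          ext ω
          have hne : ((finiteUpTo (E ω) q ∩ Iic i).encard : ℝ≥0∞) ≠ ⊤ := by
            simpa using (finite_finiteUpTo (E ω) q).subset inter_subset_left
          refine ENNReal.eq_sub_of_add_eq hne ?_
          rw [← ENat.toENNReal_add, ← encard_union_eq, ← inter_union_distrib_left]
          · congr 2
            ext t; simp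
          · refine Disjoint.inter_left' _ (Disjoint.inter_right' _ ?_)
            exact (Iic_disjoint_Ioi le_rfl).symm
        rw [this]
        exact hcount.sub (measurable_encard_finiteUpTo_inter hE hi)
      · have : ∀ ω, finiteUpTo (E ω) q ∩ Ioi i = ∅ := by
          intro ω
          ext t
          simp only [finiteUpTo, mem_inter_iff, mem_ofPred_eq, mem_Ioi, mem_empty_iff_false,
            iff_false]
          rintro ⟨⟨-, h, -⟩, h'⟩
          exact absurd (h.trans_lt hi) h'.not_gt
        simp [this]
  | compl s hs ih =>
    have : (fun ω => ∑' t : finiteUpTo (E ω) q, sᶜ.indicator (fun _ => (1 : ℝ≥0∞)) (t, ω)) =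
        fun ω => ((finiteUpTo (E ω) q).encard : ℝ≥0∞) -
          ∑' t : finiteUpTo (E ω) q, s.indicator (fun _ => (1 : ℝ≥0∞)) (t, ω) := by
      ext ω
      refine ENNReal.eq_sub_of_add_eq ?_ ?_
      · refine ne_top_of_le_ne_top (b := ((finiteUpTo (E ω) q).encard : ℝ≥0∞)) ?_ ?_
        · simpa using (finite_finiteUpTo (E ω) q)
        · rw [← ENNReal.tsum_set_one]
          exact ENNReal.tsum_le_tsum fun t => indicator_le_self' (fun _ _ => zero_le_one) _
      · rw [← ENNReal.tsum_add, ← ENNReal.tsum_set_one]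
        refine tsum_congr fun t => ?_
        by_cases h : ((t : ℝ≥0), ω) ∈ s <;> simp [h]
    rw [this]
    exact hcount.sub ih
  | iUnion f hd hf ih =>
    have : (fun ω => ∑' t : finiteUpTo (E ω) q, (⋃ i, f i).indicator (fun _ => (1 : ℝ≥0∞)) (t, ω)) =
        fun ω => ∑' i, ∑' t : finiteUpTo (E ω) q, (f i).indicator (fun _ => (1 : ℝ≥0∞)) (t, ω) := by
      ext ω
      rw [ENNReal.tsum_comm]
      refine tsum_congr fun t => ?_
      by_cases h : ((t : ℝ≥0), ω) ∈ ⋃ i, f i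
      · obtain ⟨i, hi⟩ := mem_iUnion.1 h
        rw [indicator_of_mem h, tsum_eq_single i, indicator_of_mem hi]
        exact fun j hj => indicator_of_notMem (fun hj' => (hd hj).ne_of_mem hj' hi rfl) _
      · rw [indicator_of_notMem h]
        simp only [mem_iUnion, not_exists] at h
        simp [h]
    rw [this]
    exact @Measurable.tsum Ω ℝ≥0∞ ℕ (𝓕 q) _ _ _ _ _ _ _ _ _ _ _ _ ih

/-- The sum of a predictable process over the points of an adapted point set is adapted. -/
theorem measurable_tsum_finiteUpTo
    (hE : ∀ (t : ℝ≥0) (n : ℕ), MeasurableSet[𝓕 t] {ω | (n : ℕ∞) ≤ (E ω ∩ Iic t).encard})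
    (q : ℝ≥0) {C : ℝ≥0 × Ω → ℝ≥0∞} (hC : Measurable[𝓕.predictable] C) :
    Measurable[𝓕 q] fun ω => ∑' t : finiteUpTo (E ω) q, C (t, ω) := by
  refine @Measurable.ennreal_induction _ 𝓕.predictable
    (fun C => Measurable[𝓕 q] fun ω => ∑' t : finiteUpTo (E ω) q, C (t, ω)) ?_ ?_ ?_ C hC
  · intro c B hB
    have := (measurable_tsum_indicator_finiteUpTo hE q hB).const_mul c
    convert this using 2 with ω
    rw [← ENNReal.tsum_mul_left]
    refine tsum_congr fun t => ?_
    by_cases h : ((t : ℝ≥0), ω) ∈ B <;> simp [h]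
  · intro f g _ _ _ hf hg
    simp only [Pi.add_apply, ENNReal.tsum_add]
    exact hf.add hg
  · intro f _ hmono hf
    have : (fun ω => ∑' t : finiteUpTo (E ω) q, (⨆ n, f n (t, ω))) =
        fun ω => ⨆ n, ∑' t : finiteUpTo (E ω) q, f n (t, ω) := by
      ext ω
      simp_rw [ENNReal.tsum_eq_iSup_sum]
      rw [iSup_comm]
      refine iSup_congr fun s => ?_
      rw [ENNReal.finsetSum_iSup_of_monotone]
      exact fun t i j hij => hmono hij _
    simp only [this]
    exact Measurable.iSup hf

/-- For a locally finite point set the sum is the increasing limit of the truncated sums. This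
supplies the measurability needed to add and interchange integrals below. -/
theorem aemeasurable_tsum_of_predictable {μ : Measure Ω}
    (hE : ∀ (t : ℝ≥0) (n : ℕ), MeasurableSet[𝓕 t] {ω | (n : ℕ∞) ≤ (E ω ∩ Iic t).encard})
    (hfin : ∀ᵐ ω ∂μ, ∀ t, (E ω ∩ Iic t).Finite)
    {C : ℝ≥0 → Ω → ℝ≥0∞} (hC : Measurable[𝓕.predictable] (Function.uncurry C)) :
    AEMeasurable (fun ω => ∑' t : E ω, C t ω) μ := by
  refine ⟨fun ω => ⨆ n : ℕ, ∑' t : finiteUpTo (E ω) n, C t ω, ?_, ?_⟩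
  · exact Measurable.iSup fun n => (measurable_tsum_finiteUpTo hE n hC).mono (𝓕.le _) le_rfl
  · filter_upwards [hfin] with ω hω
    have hmem : ∀ (n : ℕ) t, t ∈ finiteUpTo (E ω) n ↔ t ∈ E ω ∧ t ≤ n := fun n t => by
      simp [finiteUpTo, hω]
    simp_rw [tsum_subtype (E ω) (C · ω), tsum_subtype (finiteUpTo (E ω) _) (C · ω)]
    simp_rw [ENNReal.tsum_eq_iSup_sum]
    rw [iSup_comm]
    refine iSup_congr fun s => ?_
    rw [← ENNReal.finsetSum_iSup_of_monotone]
    · refine Finset.sum_congr rfl fun t _ => ?_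
      by_cases ht : t ∈ E ω
      · obtain ⟨n, hn⟩ := exists_nat_ge t
        refine le_antisymm ?_ (iSup_le fun n => ?_)
        · refine le_iSup_of_le n ?_
          rw [indicator_of_mem ht, indicator_of_mem ((hmem n t).2 ⟨ht, hn⟩)]
        · exact indicator_le_indicator_of_subset (finiteUpTo_subset _ _) (by simp) t
      · have : ∀ n : ℕ, t ∉ finiteUpTo (E ω) n := fun n h => ht h.1
        simp [ht, this]
    · intro t i j hij
      refine indicator_le_indicator_of_subset (fun s hs => ?_) (by simp) t
      rw [hmem] at hs ⊢
      exact ⟨hs.1, hs.2.trans (by exact_mod_cast hij)⟩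

end Measurability

/-! ### Counts of hops and predictability -/

section Counts

variable {S : Type*}

/-- The number of hops from `x` at times in `B`. -/
def numDep (e : Event S → Set ℝ≥0) (x : S) (B : Set ℝ≥0) : ℝ≥0∞ :=
  ∑' y, ((e (.hop x y) ∩ B).encard : ℝ≥0∞)

/-- The number of hops to `x` at times in `B`. -/
def numArr (e : Event S → Set ℝ≥0) (x : S) (B : Set ℝ≥0) : ℝ≥0∞ :=
  ∑' y, ((e (.hop y x) ∩ B).encard : ℝ≥0∞)

/-- `B` is a lower set in which the rational numbers are cofinal. -/
def IsRatLower (B : Set ℝ≥0) : Prop :=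
  ∀ s, s ∈ B ↔ ∃ q : ℚ, s ≤ Real.toNNReal q ∧ Real.toNNReal q ∈ B

/-- `B` is either the strict past of `t`, which makes counts predictable, or all of time, which
gives terminal values. -/
theorem isRatLower_Iio (t : ℝ≥0) : IsRatLower (Iio t) := by
  intro s
  constructor
  · intro hs
    obtain ⟨q, -, h1, h2⟩ := (NNReal.lt_iff_exists_rat_btwn s t).1 hs
    exact ⟨q, h1.le, h2⟩
  · rintro ⟨q, h1, h2⟩
    exact lt_of_le_of_lt h1 h2

theorem isRatLower_univ : IsRatLower univ := by
  intro s
  simp only [mem_univ, and_true, true_iff]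
  obtain ⟨q, -, h1, -⟩ := (NNReal.lt_iff_exists_rat_btwn s (s + 1)).1 (lt_add_one s)
  exact ⟨q, h1.le⟩

theorem IsRatLower.Iic_subset {B : Set ℝ≥0} (hB : IsRatLower B) {q : ℚ}
    (hq : Real.toNNReal q ∈ B) : Iic (Real.toNNReal q) ⊆ B :=
  fun s hs => (hB s).2 ⟨q, hs, hq⟩

/-- A set of times with at least `n + 1` elements in `B` has a subset of `n + 1` elements that lie
below one of its elements in `B`. -/
theorem exists_le_encard_inter_Iic {E B : Set ℝ≥0} {n : ℕ}
    (h : ((n + 1 : ℕ) : ℕ∞) ≤ (E ∩ B).encard) :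
    ∃ s ∈ E ∩ B, ((n + 1 : ℕ) : ℕ∞) ≤ (E ∩ B ∩ Iic s).encard := by
  obtain ⟨T, hT, hcard⟩ := exists_subset_encard_eq h
  have hfin : T.Finite := by
    rw [← encard_lt_top_iff, hcard]
    exact ENat.natCast_lt_top _
  have hne : T.Nonempty := by
    rw [← encard_pos, hcard]
    exact_mod_cast Nat.succ_pos n
  obtain ⟨s, hs, hmax⟩ := hfin.exists_maximalFor id T hne
  refine ⟨s, hT hs, ?_⟩
  rw [← hcard]
  refine encard_le_encard fun t ht => ⟨hT ht, ?_⟩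
  rcases le_total t s with h | h
  · exact h
  · exact hmax ht h

theorem le_encard_inter_iff {E B : Set ℝ≥0} (hB : IsRatLower B) (n : ℕ) :
    ((n + 1 : ℕ) : ℕ∞) ≤ (E ∩ B).encard ↔
      ∃ q : ℚ, Real.toNNReal q ∈ B ∧ ((n + 1 : ℕ) : ℕ∞) ≤ (E ∩ Iic (Real.toNNReal q)).encard := by
  constructor
  · intro h
    obtain ⟨s, hs, hle⟩ := exists_le_encard_inter_Iic h
    obtain ⟨q, hq, hqB⟩ := (hB s).1 hs.2
    exact ⟨q, hqB, hle.trans (encard_le_encard fun t ht => ⟨ht.1.1, ht.2.trans hq⟩)⟩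
  · rintro ⟨q, hq, hle⟩
    exact hle.trans (encard_le_encard (inter_subset_inter_right _ (hB.Iic_subset hq)))

/-- At some time in `B` a particle hops from `x` to `y`, and this is hop number `i` from `x`,
counted from `0`. -/
def Entered (e : Event S → Set ℝ≥0) (x y : S) (i : ℕ) (B : Set ℝ≥0) : Prop :=
  ∃ q : ℚ, Real.toNNReal q ∈ B ∧
    ∃ s ∈ finiteUpTo (e (.hop x y)) (Real.toNNReal q), numDep e x (Iio s) = i

open Classical in
/-- The conditional probability, given the hops at times in `B`, that hop number `i` from `x` goes
to `y`, when this has probability `p` a priori. -/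
def hopFactor (p : ℝ≥0∞) (e : Event S → Set ℝ≥0) (x y : S) (i : ℕ) (B : Set ℝ≥0) : ℝ≥0∞ :=
  if numDep e x B ≤ i then p else if Entered e x y i B then 1 else 0

theorem hopFactor_le_one {p : ℝ≥0∞} (hp : p ≤ 1) (e : Event S → Set ℝ≥0) (x y : S) (i : ℕ)
    (B : Set ℝ≥0) : hopFactor p e x y i B ≤ 1 := by
  unfold hopFactor
  split_ifs <;> simp [hp]

variable {Ω : Type*} {m : MeasurableSpace Ω} {𝓕 : Filtration ℝ≥0 m}

/-- What is detected at a rational time strictly before the present is a countable union of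
generating rectangles. -/
theorem measurableSet_predictable_exists_rat {A : ℚ → Set Ω}
    (hA : ∀ q : ℚ, MeasurableSet[𝓕 (Real.toNNReal q)] (A q)) :
    MeasurableSet[𝓕.predictable]
      {p : ℝ≥0 × Ω | ∃ q : ℚ, Real.toNNReal q ∈ Iio p.1 ∧ p.2 ∈ A q} := by
  have : {p : ℝ≥0 × Ω | ∃ q : ℚ, Real.toNNReal q ∈ Iio p.1 ∧ p.2 ∈ A q} =
      ⋃ q : ℚ, Ioi (Real.toNNReal q) ×ˢ A q := by
    ext p
    simp
  rw [this]
  exact @MeasurableSet.iUnion _ _ 𝓕.predictable _ _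
    fun q => measurableSet_predictable_Ioi_prod (hA q)

theorem measurableSet_exists_rat {A : ℚ → Set Ω}
    (hA : ∀ q : ℚ, MeasurableSet[𝓕 (Real.toNNReal q)] (A q)) :
    MeasurableSet {ω | ∃ q : ℚ, Real.toNNReal q ∈ (univ : Set ℝ≥0) ∧ ω ∈ A q} := by
  have : {ω | ∃ q : ℚ, Real.toNNReal q ∈ (univ : Set ℝ≥0) ∧ ω ∈ A q} = ⋃ q, A q := by
    ext p
    simp
  rw [this]
  exact MeasurableSet.iUnion fun q => 𝓕.le _ _ (hA q)

theorem measurable_encard_inter_Iio {E : Ω → Set ℝ≥0}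
    (hE : ∀ (t : ℝ≥0) (n : ℕ), MeasurableSet[𝓕 t] {ω | (n : ℕ∞) ≤ (E ω ∩ Iic t).encard}) :
    Measurable[𝓕.predictable] fun p : ℝ≥0 × Ω => ((E p.2 ∩ Iio p.1).encard : ℝ≥0∞) := by
  refine measurable_toENNReal_of_le fun n => ?_
  cases n with
  | zero => simp
  | succ n =>
    simp_rw [le_encard_inter_iff (isRatLower_Iio _)]
    exact measurableSet_predictable_exists_rat fun q => hE _ (n + 1)

theorem measurable_encard_inter_univ {E : Ω → Set ℝ≥0}
    (hE : ∀ (t : ℝ≥0) (n : ℕ), MeasurableSet[𝓕 t] {ω | (n : ℕ∞) ≤ (E ω ∩ Iic t).encard}) :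
    Measurable fun ω => ((E ω ∩ univ).encard : ℝ≥0∞) := by
  refine measurable_toENNReal_of_le fun n => ?_
  cases n with
  | zero => simp
  | succ n =>
    simp_rw [le_encard_inter_iff isRatLower_univ]
    exact measurableSet_exists_rat fun q => hE _ (n + 1)

variable [Countable S] {ev : Event S → Ω → Set ℝ≥0}

theorem measurable_numDep_Iio
    (had : ∀ (k : Event S) (t : ℝ≥0) (n : ℕ),
      MeasurableSet[𝓕 t] {ω | (n : ℕ∞) ≤ (ev k ω ∩ Iic t).encard})
    (x : S) :
    Measurable[𝓕.predictable] fun p : ℝ≥0 × Ω => numDep (ev · p.2) x (Iio p.1) :=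
  @Measurable.tsum _ _ _ 𝓕.predictable _ _ _ _ _ _ _ _ _ _ _ _
    fun y => measurable_encard_inter_Iio (had (.hop x y))

theorem measurable_numArr_Iio
    (had : ∀ (k : Event S) (t : ℝ≥0) (n : ℕ),
      MeasurableSet[𝓕 t] {ω | (n : ℕ∞) ≤ (ev k ω ∩ Iic t).encard})
    (x : S) :
    Measurable[𝓕.predictable] fun p : ℝ≥0 × Ω => numArr (ev · p.2) x (Iio p.1) :=
  @Measurable.tsum _ _ _ 𝓕.predictable _ _ _ _ _ _ _ _ _ _ _ _
    fun y => measurable_encard_inter_Iio (had (.hop y x))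

theorem measurable_numDep_univ
    (had : ∀ (k : Event S) (t : ℝ≥0) (n : ℕ),
      MeasurableSet[𝓕 t] {ω | (n : ℕ∞) ≤ (ev k ω ∩ Iic t).encard})
    (x : S) : Measurable fun ω => numDep (ev · ω) x univ :=
  Measurable.tsum fun y => measurable_encard_inter_univ (had (.hop x y))

/-- Such a point exists exactly when the sum of the indicator of a predictable set over the points
is nonzero. -/
theorem measurableSet_exists_finiteUpTo
    (had : ∀ (k : Event S) (t : ℝ≥0) (n : ℕ),
      MeasurableSet[𝓕 t] {ω | (n : ℕ∞) ≤ (ev k ω ∩ Iic t).encard})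
    (x y : S) (i : ℕ) (q : ℝ≥0) :
    MeasurableSet[𝓕 q]
      {ω | ∃ s ∈ finiteUpTo (ev (.hop x y) ω) q, numDep (ev · ω) x (Iio s) = i} := by
  have hB : MeasurableSet[𝓕.predictable]
      {p : ℝ≥0 × Ω | numDep (ev · p.2) x (Iio p.1) = i} :=
    measurable_numDep_Iio had x (measurableSet_singleton _)
  have := measurable_tsum_indicator_finiteUpTo (had (.hop x y)) q hB
  have h2 := this (measurableSet_singleton (0 : ℝ≥0∞)).compl
  convert h2 using 1
  ext ω
  simp [Set.indicator_apply]

theorem measurable_hopFactor_Iio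
    (had : ∀ (k : Event S) (t : ℝ≥0) (n : ℕ),
      MeasurableSet[𝓕 t] {ω | (n : ℕ∞) ≤ (ev k ω ∩ Iic t).encard})
    (p : ℝ≥0∞) (x y : S) (i : ℕ) :
    Measurable[𝓕.predictable] fun z : ℝ≥0 × Ω => hopFactor p (ev · z.2) x y i (Iio z.1) := by
  refine Measurable.ite (measurable_numDep_Iio had x measurableSet_Iic) measurable_const ?_
  refine Measurable.ite ?_ measurable_const measurable_const
  exact measurableSet_predictable_exists_rat
    fun q => measurableSet_exists_finiteUpTo had x y i (Real.toNNReal q)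

theorem measurable_hopFactor_univ
    (had : ∀ (k : Event S) (t : ℝ≥0) (n : ℕ),
      MeasurableSet[𝓕 t] {ω | (n : ℕ∞) ≤ (ev k ω ∩ Iic t).encard})
    (p : ℝ≥0∞) (x y : S) (i : ℕ) :
    Measurable fun ω => hopFactor p (ev · ω) x y i univ := by
  refine Measurable.ite (measurable_numDep_univ had x measurableSet_Iic) measurable_const ?_
  refine Measurable.ite ?_ measurable_const measurable_const
  exact measurableSet_exists_rat
    fun q => measurableSet_exists_finiteUpTo had x y i (Real.toNNReal q)

end Counts

/-! ### Realizations without accumulation and without simultaneous events -/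

section Regular

variable {S : Type*}

/-- Finitely many events happen at any vertex in finite time, and no two at the same time. -/
structure Regular (e : Event S → Set ℝ≥0) : Prop where
  finite : ∀ (x : S) (t : ℝ≥0), ((arrivals e x ∪ departures e x ∪ e (.sleep x)) ∩ Iic t).Finite
  disjoint : Pairwise fun k l : Event S => Disjoint (e k) (e l)

theorem tsum_encard_eq_encard_iUnion {ι α : Type*} {s : ι → Set α}
    (hs : Pairwise fun i j => Disjoint (s i) (s j)) :
    ∑' i, ((s i).encard : ℝ≥0∞) = ((⋃ i, s i).encard : ℝ≥0∞) := by
  simp_rw [← ENNReal.tsum_set_one]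
  have h : ∀ s : Set α, ∑' _ : s, (1 : ℝ≥0∞) = ∑' t, s.indicator (fun _ => (1 : ℝ≥0∞)) t :=
    fun s => tsum_subtype s fun _ => (1 : ℝ≥0∞)
  simp_rw [h]
  rw [ENNReal.tsum_comm]
  refine tsum_congr fun t => ?_
  by_cases ht : t ∈ ⋃ i, s i
  · obtain ⟨i, hi⟩ := mem_iUnion.1 ht
    rw [indicator_of_mem ht, tsum_eq_single i, indicator_of_mem hi]
    exact fun j hj => indicator_of_notMem (fun hj' => (hs hj).ne_of_mem hj' hi rfl) _
  · rw [indicator_of_notMem ht]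
    simp only [mem_iUnion, not_exists] at ht
    simp [ht]

namespace Regular

variable {e : Event S → Set ℝ≥0}

theorem finite_departures (he : Regular e) (x : S) (t : ℝ≥0) : (departures e x ∩ Iic t).Finite :=
  (he.finite x t).subset (inter_subset_inter_left _ fun _ h => Or.inl (Or.inr h))

theorem finite_arrivals (he : Regular e) (x : S) (t : ℝ≥0) : (arrivals e x ∩ Iic t).Finite :=
  (he.finite x t).subset (inter_subset_inter_left _ fun _ h => Or.inl (Or.inl h))

theorem finite_hop (he : Regular e) (x y : S) (t : ℝ≥0) : (e (.hop x y) ∩ Iic t).Finite :=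
  (he.finite_departures x t).subset (inter_subset_inter_left _ (subset_iUnion_of_subset y le_rfl))

theorem finite_sleep (he : Regular e) (x : S) (t : ℝ≥0) : (e (.sleep x) ∩ Iic t).Finite :=
  (he.finite x t).subset (inter_subset_inter_left _ fun _ h => Or.inr h)

/-- Summing over targets makes `numDep` measurable in every realization; without simultaneous events
nothing is counted twice. -/
theorem numDep_eq (he : Regular e) (x : S) (B : Set ℝ≥0) :
    numDep e x B = ((departures e x ∩ B).encard : ℝ≥0∞) := by
  rw [numDep, tsum_encard_eq_encard_iUnion, departures, iUnion_inter]
  exact fun y z hyz => (he.disjoint (by simpa using hyz)).mono inter_subset_left inter_subset_left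

theorem numArr_eq (he : Regular e) (x : S) (B : Set ℝ≥0) :
    numArr e x B = ((arrivals e x ∩ B).encard : ℝ≥0∞) := by
  rw [numArr, tsum_encard_eq_encard_iUnion, arrivals, iUnion_inter]
  exact fun y z hyz => (he.disjoint (by simpa using hyz)).mono inter_subset_left inter_subset_left

end Regular

/-- Hop number `i` from `x`, counted from `0`, happens at time `t`. -/
def IsHopTime (e : Event S → Set ℝ≥0) (x : S) (i : ℕ) (t : ℝ≥0) : Prop :=
  t ∈ departures e x ∧ numDep e x (Iio t) = i

namespace Regular

variable {e : Event S → Set ℝ≥0}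

theorem lt_numDep_of_mem (he : Regular e) {x : S} {i : ℕ} {t : ℝ≥0} (ht : IsHopTime e x i t)
    {B : Set ℝ≥0} (hB : Iic t ⊆ B) : (i : ℝ≥0∞) < numDep e x B := by
  have h1 : (departures e x ∩ Iio t).encard = i := by
    have := ht.2
    rw [he.numDep_eq] at this
    exact_mod_cast this
  have h2 : ((i + 1 : ℕ) : ℕ∞) ≤ (departures e x ∩ B).encard := by
    have h3 : insert t (departures e x ∩ Iio t) ⊆ departures e x ∩ B := by
      rintro s (rfl | hs)
      · exact ⟨ht.1, hB (mem_Iic.2 le_rfl)⟩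
      · exact ⟨hs.1, hB (mem_Iic.2 (le_of_lt hs.2))⟩
    have := encard_le_encard h3
    rw [encard_insert_of_notMem (by simp), h1] at this
    exact_mod_cast this
  rw [he.numDep_eq]
  have h3 := ENat.toENNReal_le.2 h2
  refine lt_of_lt_of_le ?_ h3
  exact_mod_cast Nat.lt_succ_self i

theorem isHopTime_unique (he : Regular e) {x : S} {i : ℕ} {t t' : ℝ≥0} (ht : IsHopTime e x i t)
    (ht' : IsHopTime e x i t') : t = t' := by
  by_contra hne
  wlog h : t < t' generalizing t t'
  · exact this ht' ht (Ne.symm hne) (lt_of_le_of_ne (not_lt.1 h) (Ne.symm hne))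
  have := he.lt_numDep_of_mem ht (B := Iio t') (fun s hs => lt_of_le_of_lt hs h)
  rw [ht'.2] at this
  exact lt_irrefl _ this

/-- By local finiteness there is a first departure in `B` up to which at least `i + 1` hops occur.
Minimality leaves at most `i` hops strictly before it, and removing one point leaves at least `i`.
-/
theorem exists_isHopTime (he : Regular e) {x : S} {i : ℕ} {B : Set ℝ≥0} (hB : IsLowerSet B)
    (h : (i : ℝ≥0∞) < numDep e x B) : ∃ t ∈ B, IsHopTime e x i t := by
  rw [he.numDep_eq] at h
  have h' : ((i + 1 : ℕ) : ℕ∞) ≤ (departures e x ∩ B).encard := by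
    have : (i : ℕ∞) < (departures e x ∩ B).encard := by exact_mod_cast h
    exact_mod_cast Order.add_one_le_of_lt this
  set U := {t | t ∈ departures e x ∩ B ∧ ((i + 1 : ℕ) : ℕ∞) ≤ (departures e x ∩ Iic t).encard}
  obtain ⟨s, hs, hsc⟩ := exists_le_encard_inter_Iic h'
  have hsU : s ∈ U :=
    ⟨hs, hsc.trans (encard_le_encard (inter_subset_inter_left _ inter_subset_left))⟩
  have hfin : (U ∩ Iic s).Finite :=
    (he.finite_departures x s).subset fun t ht => ⟨ht.1.1.1, ht.2⟩
  obtain ⟨t, ⟨htU, hts⟩, hmin⟩ := hfin.exists_minimalFor id _ ⟨s, hsU, mem_Iic.2 le_rfl⟩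
  refine ⟨t, htU.1.2, htU.1.1, ?_⟩
  rw [he.numDep_eq]
  have hle : (departures e x ∩ Iio t).encard ≤ i := by
    by_contra hlt
    have hlt' : ((i + 1 : ℕ) : ℕ∞) ≤ (departures e x ∩ Iio t).encard := by
      exact_mod_cast Order.add_one_le_of_lt (not_le.1 hlt)
    obtain ⟨u, hu, huc⟩ := exists_le_encard_inter_Iic hlt'
    have huU : u ∈ U ∩ Iic s := by
      refine ⟨⟨⟨hu.1, hB (le_of_lt hu.2) htU.1.2⟩, ?_⟩, mem_Iic.2 ((le_of_lt hu.2).trans hts)⟩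
      exact huc.trans (encard_le_encard (inter_subset_inter_left _ inter_subset_left))
    exact absurd (hmin huU (le_of_lt hu.2)) (not_le.2 hu.2)
  have hge : (i : ℕ∞) ≤ (departures e x ∩ Iio t).encard := by
    have h1 : departures e x ∩ Iic t ⊆ insert t (departures e x ∩ Iio t) := by
      rintro u ⟨hu, hut⟩
      rcases eq_or_lt_of_le (mem_Iic.1 hut) with h | h
      · exact Or.inl h
      · exact Or.inr ⟨hu, h⟩
    have h2 := (htU.2.trans (encard_le_encard h1)).trans (encard_insert_le _ _)
    push_cast at h2
    exact (ENat.add_le_add_iff_right ENat.one_ne_top).1 h2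
  exact_mod_cast le_antisymm hle hge

theorem entered_iff (he : Regular e) {x y : S} {i : ℕ} {B : Set ℝ≥0} (hB : IsRatLower B) :
    Entered e x y i B ↔ ∃ t ∈ B, t ∈ e (.hop x y) ∧ IsHopTime e x i t := by
  constructor
  · rintro ⟨q, hq, s, hs, hd⟩
    exact ⟨s, hB.Iic_subset hq hs.2.1, hs.1, mem_iUnion.2 ⟨y, hs.1⟩, hd⟩
  · rintro ⟨t, htB, hte, ht⟩
    obtain ⟨q, hq, hqB⟩ := (hB t).1 htB
    exact ⟨q, hqB, t, ⟨hte, hq, he.finite_hop x y _⟩, ht.2⟩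

end Regular

end Regular

/-! ### The hops from each vertex are independent with law `P` -/

section Jumps

open Classical in
/-- If the factors `p a` of a product are replaced by `x a` one at a time, in the order of the times
`τ a`, then the product changes by the sum of the changes. -/
theorem prod_add_sum_jumps {ι R : Type*} [CommSemiring R] (s : Finset ι) (τ : ι → ℝ≥0∞)
    (p x : ι → R) (hτ : ∀ a ∈ s, ∀ b ∈ s, τ a ≠ ⊤ → τ a = τ b → a = b)
    (hx : ∀ a ∈ s, τ a = ⊤ → x a = p a) :
    ∏ a ∈ s, x a + ∑ a ∈ s, (if τ a = ⊤ then 0 else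
        p a * ∏ b ∈ s.erase a, if τ b < τ a then x b else p b) =
      ∏ a ∈ s, p a + ∑ a ∈ s, (if τ a = ⊤ then 0 else
        x a * ∏ b ∈ s.erase a, if τ b < τ a then x b else p b) := by
  -- The index inserted has the largest time, so its factor is still `p a` at all earlier jumps, and
  -- at its own jump all other factors have been replaced. Removed values stand on the left because
  -- `R` has no subtraction.
  induction s using Finset.induction_on_max_value τ with
  | empty => simp
  | insert a s ha hmax ih =>
    have ih := ih
      (fun b hb c hc => hτ b (Finset.mem_insert_of_mem hb) c (Finset.mem_insert_of_mem hc))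
      (fun b hb => hx b (Finset.mem_insert_of_mem hb))
    have hR : ∀ z : ι → R, ∑ b ∈ s, (if τ b = ⊤ then 0 else
        z b * ∏ c ∈ (insert a s).erase b, if τ c < τ b then x c else p c) =
        p a * ∑ b ∈ s, (if τ b = ⊤ then 0 else
        z b * ∏ c ∈ s.erase b, if τ c < τ b then x c else p c) := by
      intro z
      rw [Finset.mul_sum]
      refine Finset.sum_congr rfl fun b hb => ?_
      have hne : a ≠ b := fun h => ha (h ▸ hb)
      rw [Finset.erase_insert_of_ne hne,
        Finset.prod_insert (fun h => ha (Finset.mem_of_mem_erase h)),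
        if_neg (not_lt.2 (hmax b hb))]
      split_ifs
      · simp
      · ring
    rw [Finset.prod_insert ha, Finset.prod_insert ha, Finset.sum_insert ha, Finset.sum_insert ha,
      hR, hR, Finset.erase_insert ha]
    by_cases htop : τ a = ⊤
    · rw [if_pos htop, if_pos htop, hx a (Finset.mem_insert_self _ _) htop, zero_add, zero_add,
        ← mul_add, ← mul_add, ih]
    · rw [if_neg htop, if_neg htop]
      have : ∏ b ∈ s, (if τ b < τ a then x b else p b) = ∏ b ∈ s, x b := by
        refine Finset.prod_congr rfl fun b hb => if_pos (lt_of_le_of_ne (hmax b hb) fun h => ?_)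
        exact ha (hτ a (Finset.mem_insert_self _ _) b (Finset.mem_insert_of_mem hb) htop
          h.symm ▸ hb)
      rw [this]
      calc x a * ∏ b ∈ s, x b + (p a * ∏ b ∈ s, x b + p a * _)
          = x a * ∏ b ∈ s, x b + p a * (∏ b ∈ s, x b + _) := by rw [← mul_add]
        _ = _ := by rw [ih]; ring

variable {S : Type*}

open Classical in
/-- The time of hop number `i` from `x`, or `∞` if there are at most `i` hops from `x`. -/
def hopTime (e : Event S → Set ℝ≥0) (x : S) (i : ℕ) : ℝ≥0∞ :=
  if h : ∃ t, IsHopTime e x i t then (h.choose : ℝ≥0∞) else ⊤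

variable {e : Event S → Set ℝ≥0}

theorem Regular.hopTime_eq (he : Regular e) {x : S} {i : ℕ} {t : ℝ≥0} (ht : IsHopTime e x i t) :
    hopTime e x i = t := by
  have h : ∃ t, IsHopTime e x i t := ⟨t, ht⟩
  rw [hopTime, dif_pos h, he.isHopTime_unique h.choose_spec ht]

theorem hopTime_eq_top {x : S} {i : ℕ} (h : ¬ ∃ t, IsHopTime e x i t) : hopTime e x i = ⊤ :=
  dif_neg h

theorem Regular.numDep_le_iff (he : Regular e) {x : S} {i : ℕ} {B : Set ℝ≥0} (hB : IsLowerSet B) :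
    numDep e x B ≤ i ↔ ∀ t, IsHopTime e x i t → t ∉ B := by
  constructor
  · intro h t ht htB
    exact absurd h (not_le.2 (he.lt_numDep_of_mem ht fun s hs => hB hs htB))
  · intro h
    by_contra hlt
    obtain ⟨t, htB, ht⟩ := he.exists_isHopTime hB (not_le.1 hlt)
    exact h t ht htB

open Classical in
-- As a function of time the factor is a left-continuous step: `p` up to and including the time of
-- the hop, its terminal value afterwards.
theorem Regular.hopFactor_Iio (he : Regular e) (p : ℝ≥0∞) (x y : S) (i : ℕ) (t : ℝ≥0) :
    hopFactor p e x y i (Iio t) = if hopTime e x i < t then hopFactor p e x y i univ else p := by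
  by_cases h : ∃ s, IsHopTime e x i s
  · obtain ⟨s, hs⟩ := h
    rw [he.hopTime_eq hs]
    by_cases hst : s < t
    · rw [if_pos (by exact_mod_cast hst)]
      have h1 : ¬ numDep e x (Iio t) ≤ i := by
        rw [he.numDep_le_iff (isLowerSet_Iio t)]
        exact fun H => H s hs hst
      have h2 : ¬ numDep e x univ ≤ i := by
        rw [he.numDep_le_iff isLowerSet_univ]
        exact fun H => H s hs (mem_univ _)
      have : Entered e x y i (Iio t) ↔ Entered e x y i univ := by
        rw [he.entered_iff (isRatLower_Iio t), he.entered_iff isRatLower_univ]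
        constructor
        · rintro ⟨u, -, h⟩
          exact ⟨u, mem_univ _, h⟩
        · rintro ⟨u, -, h⟩
          exact ⟨u, by rw [he.isHopTime_unique h.2 hs]; exact hst, h⟩
      simp only [hopFactor, if_neg h1, if_neg h2, this]
    · rw [if_neg (by exact_mod_cast hst)]
      unfold hopFactor
      rw [if_pos]
      rw [he.numDep_le_iff (isLowerSet_Iio t)]
      intro u hu
      rwa [he.isHopTime_unique hu hs]
  · rw [hopTime_eq_top h, if_neg (by simp)]
    unfold hopFactor
    rw [if_pos]
    rw [he.numDep_le_iff (isLowerSet_Iio t)]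
    exact fun u hu => absurd ⟨u, hu⟩ h

theorem Regular.hopTime_injective (he : Regular e) {x y : S} {i j : ℕ}
    (hne : hopTime e x i ≠ ⊤) (h : hopTime e x i = hopTime e y j) : x = y ∧ i = j := by
  have h1 : ∃ t, IsHopTime e x i t := by_contra fun H => hne (hopTime_eq_top H)
  have h2 : ∃ t, IsHopTime e y j t := by_contra fun H => hne (h.trans (hopTime_eq_top H))
  obtain ⟨t, ht⟩ := h1
  obtain ⟨u, hu⟩ := h2
  rw [he.hopTime_eq ht, he.hopTime_eq hu] at h
  obtain rfl : t = u := by exact_mod_cast h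
  obtain ⟨a, ha⟩ := mem_iUnion.1 ht.1
  obtain ⟨b, hb⟩ := mem_iUnion.1 hu.1
  have hxy : x = y := by
    by_contra hne
    exact (he.disjoint (i := .hop x a) (j := .hop y b) (by simp [hne])).ne_of_mem ha hb rfl
  subst hxy
  refine ⟨rfl, ?_⟩
  have := ht.2.symm.trans hu.2
  exact_mod_cast this

open Classical in
/-- The indicator of the next hop from `x` being number `i`, times a process. -/
def atHop (e : Event S → Set ℝ≥0) (x : S) (i : ℕ) (R : ℝ≥0 → ℝ≥0∞) (t : ℝ≥0) : ℝ≥0∞ :=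
  if numDep e x (Iio t) = i then R t else 0

/-- Only the time of hop `i` can contribute. Once that hop happens, `hopFactor` is the indicator
that it goes to `y` whatever its a priori value, here 0. -/
theorem Regular.tsum_hop_atHop (he : Regular e) (x y : S) (i : ℕ) (R : ℝ≥0 → ℝ≥0∞) :
    ∑' t : e (.hop x y), atHop e x i R t =
      if hopTime e x i = ⊤ then 0 else
        hopFactor 0 e x y i univ * R (hopTime e x i).toNNReal := by
  classical
  by_cases h : ∃ s, IsHopTime e x i s
  · obtain ⟨s, hs⟩ := h
    rw [he.hopTime_eq hs, if_neg (by simp), ENNReal.toNNReal_coe, hopFactor, if_neg]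
    · rw [he.entered_iff isRatLower_univ]
      by_cases hsy : s ∈ e (.hop x y)
      · rw [if_pos ⟨s, mem_univ _, hsy, hs⟩, tsum_eq_single ⟨s, hsy⟩]
        · simp [atHop, hs.2]
        · rintro ⟨t, ht⟩ hne
          refine if_neg fun hd => hne ?_
          exact Subtype.ext (he.isHopTime_unique ⟨mem_iUnion.2 ⟨y, ht⟩, hd⟩ hs)
      · rw [if_neg, zero_mul, ENNReal.tsum_eq_zero]
        · rintro ⟨t, ht⟩
          refine if_neg fun hd => hsy ?_
          rwa [← he.isHopTime_unique ⟨mem_iUnion.2 ⟨y, ht⟩, hd⟩ hs]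
        · rintro ⟨t, -, ht, htt⟩
          exact hsy (he.isHopTime_unique htt hs ▸ ht)
    · rw [he.numDep_le_iff isLowerSet_univ]
      exact fun H => H s hs (mem_univ _)
  · rw [hopTime_eq_top h, if_pos rfl, ENNReal.tsum_eq_zero]
    rintro ⟨t, ht⟩
    exact if_neg fun hd => h ⟨t, mem_iUnion.2 ⟨y, ht⟩, hd⟩

theorem Regular.tsum_tsum_hop_atHop (he : Regular e) (x : S) (i : ℕ) (R : ℝ≥0 → ℝ≥0∞) :
    ∑' y, ∑' t : e (.hop x y), atHop e x i R t =
      if hopTime e x i = ⊤ then 0 else R (hopTime e x i).toNNReal := by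
  classical
  simp_rw [he.tsum_hop_atHop]
  by_cases h : ∃ s, IsHopTime e x i s
  · obtain ⟨s, hs⟩ := h
    obtain ⟨y, hy⟩ := mem_iUnion.1 hs.1
    have hlt : ¬ numDep e x univ ≤ i := by
      rw [he.numDep_le_iff isLowerSet_univ]
      exact fun H => H s hs (mem_univ _)
    simp only [he.hopTime_eq hs, ENNReal.coe_ne_top, if_false, hopFactor, if_neg hlt]
    rw [tsum_eq_single y, if_pos, one_mul]
    · exact (he.entered_iff isRatLower_univ).2 ⟨s, mem_univ _, hy, hs⟩
    · intro z hz
      rw [if_neg, zero_mul]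
      rw [he.entered_iff isRatLower_univ]
      rintro ⟨t, -, ht, htt⟩
      rw [he.isHopTime_unique htt hs] at ht
      exact (he.disjoint (i := .hop x z) (j := .hop x y) (by simpa using hz)).ne_of_mem ht hy rfl
  · simp [hopTime_eq_top h]

theorem hopFactor_univ_of_ne_top (he : Regular e) {x : S} {i : ℕ} (h : hopTime e x i ≠ ⊤)
    (p p' : ℝ≥0∞) (y : S) : hopFactor p e x y i univ = hopFactor p' e x y i univ := by
  have h1 : ∃ t, IsHopTime e x i t := by_contra fun H => h (hopTime_eq_top H)
  obtain ⟨s, hs⟩ := h1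
  have hlt : ¬ numDep e x univ ≤ i := by
    rw [he.numDep_le_iff isLowerSet_univ]
    exact fun H => H s hs (mem_univ _)
  simp [hopFactor, hlt]

theorem hopFactor_univ_of_eq_top (he : Regular e) {x : S} {i : ℕ} (h : hopTime e x i = ⊤)
    (p : ℝ≥0∞) (y : S) : hopFactor p e x y i univ = p := by
  rw [hopFactor, if_pos]
  rw [he.numDep_le_iff isLowerSet_univ]
  intro t ht
  rw [he.hopTime_eq ht] at h
  simp at h

open Classical in
/-- Decomposition of a product of conditional probabilities into its jumps. -/
theorem Regular.prod_hopFactor_add (he : Regular e) {ι : Type*} (s : Finset ι) (v : ι → S)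
    (n : ι → ℕ) (y : ι → S) (p : ι → ℝ≥0∞)
    (hinj : ∀ a ∈ s, ∀ b ∈ s, v a = v b → n a = n b → a = b) :
    ∏ a ∈ s, hopFactor (p a) e (v a) (y a) (n a) univ +
        ∑ a ∈ s, p a * ∑' z, ∑' t : e (.hop (v a) z), atHop e (v a) (n a)
          (fun t => ∏ b ∈ s.erase a, hopFactor (p b) e (v b) (y b) (n b) (Iio t)) t =
      ∏ a ∈ s, p a +
        ∑ a ∈ s, ∑' t : e (.hop (v a) (y a)), atHop e (v a) (n a)
          (fun t => ∏ b ∈ s.erase a, hopFactor (p b) e (v b) (y b) (n b) (Iio t)) t := by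
  have key := prod_add_sum_jumps s (fun a => hopTime e (v a) (n a)) p
    (fun a => hopFactor (p a) e (v a) (y a) (n a) univ)
    (fun a ha b hb hne h => by
      obtain ⟨h1, h2⟩ := he.hopTime_injective hne h
      exact hinj a ha b hb h1 h2)
    (fun a _ h => hopFactor_univ_of_eq_top he h _ _)
  convert key using 3 with a ha a ha
  · rw [he.tsum_tsum_hop_atHop, mul_ite, mul_zero]
    split_ifs with h
    · rfl
    · simp_rw [he.hopFactor_Iio, ENNReal.coe_toNNReal h]
  · rw [he.tsum_hop_atHop]
    split_ifs with h
    · rfl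
    · simp_rw [he.hopFactor_Iio, ENNReal.coe_toNNReal h]
      rw [hopFactor_univ_of_ne_top he h 0 (p a)]

end Jumps

/-! ### Compensation: the product of conditional probabilities has constant mean -/

section Expectation

variable {S Ω : Type*} {m : MeasurableSpace Ω} {P : S → PMF S} {η₀ : S → ℕ}
  {lam : ℝ≥0∞} {μ : Measure Ω} {𝓕 : Filtration ℝ≥0 m} {ev : Event S → Ω → Set ℝ≥0}

theorem IsARW.ae_regular (h : IsARW P η₀ lam μ 𝓕 ev) : ∀ᵐ ω ∂μ, Regular (ev · ω) := by
  filter_upwards [h.locally_finite, h.no_simultaneous] with ω h1 h2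
  exact ⟨h1, h2⟩

theorem measurable_atHop [Countable S] {ev : Event S → Ω → Set ℝ≥0}
    (had : ∀ (k : Event S) (t : ℝ≥0) (n : ℕ),
      MeasurableSet[𝓕 t] {ω | (n : ℕ∞) ≤ (ev k ω ∩ Iic t).encard}) (x : S) (i : ℕ)
    {R : ℝ≥0 → Ω → ℝ≥0∞} (hR : Measurable[𝓕.predictable] (Function.uncurry R)) :
    Measurable[𝓕.predictable]
      (Function.uncurry fun t ω => atHop (ev · ω) x i (fun t => R t ω) t) :=
  Measurable.ite (measurable_numDep_Iio had x (measurableSet_singleton _)) hR measurable_const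

theorem IsARW.aemeasurable_tsum_hop (h : IsARW P η₀ lam μ 𝓕 ev) (x y : S) {C : ℝ≥0 → Ω → ℝ≥0∞}
    (hC : Measurable[𝓕.predictable] (Function.uncurry C)) :
    AEMeasurable (fun ω => ∑' t : ev (.hop x y) ω, C t ω) μ :=
  aemeasurable_tsum_of_predictable (h.adapted _)
    (h.ae_regular.mono fun _ he t => he.finite_hop x y t) hC

/-- The expected integral of `C` against the number of active particles at `x`. -/
def activeIntegral (η₀ : S → ℕ) (lam : ℝ≥0∞) (μ : Measure Ω) (ev : Event S → Ω → Set ℝ≥0) (x : S)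
    (C : ℝ≥0 → Ω → ℝ≥0∞) : ℝ≥0∞ :=
  ∫⁻ ω, (∫⁻ t in Ici (0 : ℝ),
    C t.toNNReal ω * activeParticles η₀ lam (ev · ω) x t.toNNReal) ∂μ

/-- The target enters the intensity only through the constant `P x y`. Being finite, it can be taken
out of the integrals without measurability of the number of active particles. -/
theorem IsARW.lintegral_tsum_hop (h : IsARW P η₀ lam μ 𝓕 ev) (x y : S) {C : ℝ≥0 → Ω → ℝ≥0∞}
    (hC : Measurable[𝓕.predictable] (Function.uncurry C)) :
    ∫⁻ ω, ∑' t : ev (.hop x y) ω, C t ω ∂μ = activeIntegral η₀ lam μ ev x C * P x y := by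
  rw [h.intensity _ C hC, activeIntegral, ← lintegral_mul_const' _ _ ((P x).apply_ne_top y)]
  refine lintegral_congr fun ω => ?_
  rw [← lintegral_mul_const' _ _ ((P x).apply_ne_top y)]
  refine lintegral_congr fun t => ?_
  rw [rate, mul_assoc]

theorem IsARW.lintegral_tsum_tsum_hop [Countable S] (h : IsARW P η₀ lam μ 𝓕 ev) (x : S)
    {C : ℝ≥0 → Ω → ℝ≥0∞}
    (hC : Measurable[𝓕.predictable] (Function.uncurry C)) :
    ∫⁻ ω, ∑' y, ∑' t : ev (.hop x y) ω, C t ω ∂μ = activeIntegral η₀ lam μ ev x C := by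
  rw [lintegral_tsum fun y => h.aemeasurable_tsum_hop x y hC]
  simp_rw [h.lintegral_tsum_hop x _ hC]
  rw [ENNReal.tsum_mul_left, (P x).tsum_coe, mul_one]

/-- When hop `n a` from `v a` happens, the factor `p a` is replaced by the indicator of the target
`y a`. Hops to `y a` carry the fraction `p a` of the total intensity, so the gains and losses in
`Regular.prod_hopFactor_add` have equal means and cancel. -/
theorem IsARW.lintegral_prod_hopFactor [Countable S] [IsProbabilityMeasure μ]
    (h : IsARW P η₀ lam μ 𝓕 ev)
    {ι : Type*} (s : Finset ι) (v : ι → S) (n : ι → ℕ) (y : ι → S)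
    (hinj : ∀ a ∈ s, ∀ b ∈ s, v a = v b → n a = n b → a = b) :
    ∫⁻ ω, ∏ a ∈ s, hopFactor (P (v a) (y a)) (ev · ω) (v a) (y a) (n a) univ ∂μ =
      ∏ a ∈ s, P (v a) (y a) := by
  classical
  set p : ι → ℝ≥0∞ := fun a => P (v a) (y a)
  set C : ι → ℝ≥0 → Ω → ℝ≥0∞ := fun a t ω => atHop (ev · ω) (v a) (n a)
    (fun t => ∏ b ∈ s.erase a, hopFactor (p b) (ev · ω) (v b) (y b) (n b) (Iio t)) t
  have hC : ∀ a, Measurable[𝓕.predictable] (Function.uncurry (C a)) := by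
    intro a
    refine measurable_atHop h.adapted _ _
      (R := fun t ω => ∏ b ∈ s.erase a, hopFactor (p b) (ev · ω) (v b) (y b) (n b) (Iio t)) ?_
    exact Finset.measurable_fun_prod _ fun b _ => measurable_hopFactor_Iio h.adapted _ _ _ _
  -- Hop number `n a` happens at most once and the other factors are at most 1; this finiteness
  -- justifies the final cancellation.
  have hK : ∀ a, activeIntegral η₀ lam μ ev (v a) (C a) ≤ 1 := by
    intro a
    rw [← h.lintegral_tsum_tsum_hop _ (hC a)]
    calc _ ≤ ∫⁻ _, 1 ∂μ := by
          refine lintegral_mono_ae ?_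
          filter_upwards [h.ae_regular] with ω he
          rw [he.tsum_tsum_hop_atHop]
          split_ifs
          · exact zero_le_one
          · exact Finset.prod_le_one' fun b _ => hopFactor_le_one ((P _).coe_le_one _) _ _ _ _ _
      _ = 1 := by simp
  have hmW : Measurable fun ω => ∏ a ∈ s, hopFactor (p a) (ev · ω) (v a) (y a) (n a) univ :=
    Finset.measurable_fun_prod _ fun b _ => measurable_hopFactor_univ h.adapted _ _ _ _
  have hmL : ∀ a, AEMeasurable (fun ω => ∑' z, ∑' t : ev (.hop (v a) z) ω, C a t ω) μ :=
    fun a => AEMeasurable.tsum fun z => h.aemeasurable_tsum_hop _ _ (hC a)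
  have hint : ∫⁻ ω, (∏ a ∈ s, hopFactor (p a) (ev · ω) (v a) (y a) (n a) univ +
        ∑ a ∈ s, p a * ∑' z, ∑' t : ev (.hop (v a) z) ω, C a t ω) ∂μ =
      ∫⁻ ω, (∏ a ∈ s, p a + ∑ a ∈ s, ∑' t : ev (.hop (v a) (y a)) ω, C a t ω) ∂μ := by
    refine lintegral_congr_ae ?_
    filter_upwards [h.ae_regular] with ω he
    exact he.prod_hopFactor_add s v n y p hinj
  rw [lintegral_add_left hmW, lintegral_add_left measurable_const,
    lintegral_finsetSum' _ fun a _ => (hmL a).const_mul _,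
    lintegral_finsetSum' _ fun a _ => h.aemeasurable_tsum_hop _ _ (hC a), lintegral_const,
    measure_univ, mul_one] at hint
  have hsum : ∑ a ∈ s, ∫⁻ ω, p a * ∑' z, ∑' t : ev (.hop (v a) z) ω, C a t ω ∂μ =
      ∑ a ∈ s, ∫⁻ ω, ∑' t : ev (.hop (v a) (y a)) ω, C a t ω ∂μ := by
    refine Finset.sum_congr rfl fun a _ => ?_
    rw [lintegral_const_mul'' _ (hmL a), h.lintegral_tsum_tsum_hop _ (hC a),
      h.lintegral_tsum_hop _ _ (hC a), mul_comm]
  rw [hsum] at hint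
  refine (ENNReal.add_left_inj ?_).1 hint
  refine ENNReal.sum_ne_top.2 fun a _ => ?_
  rw [h.lintegral_tsum_hop _ _ (hC a)]
  exact ENNReal.mul_ne_top (ne_top_of_le_ne_top ENNReal.one_ne_top (hK a)) ((P _).apply_ne_top _)

end Expectation

/-! ### A vertex with two particles does not stay blocked -/

section Blocked

variable {S : Type*} {e : Event S → Set ℝ≥0}

namespace Regular

/-- With the lower bound 2 the truncation of the subtraction is harmless, so hops from empty
vertices need not be excluded. -/
theorem two_le_particles_iff (he : Regular e) (η₀ : S → ℕ) (x : S) (t : ℝ≥0) :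
    2 ≤ particles η₀ e x t ↔ 2 + numDep e x (Iic t) ≤ η₀ x + numArr e x (Iic t) := by
  rw [he.numDep_eq, he.numArr_eq, ← (he.finite_departures x t).cast_ncard_eq,
    ← (he.finite_arrivals x t).cast_ncard_eq, particles]
  simp only [ENat.toENNReal_coe]
  norm_cast
  omega

theorem numDep_Iic (he : Regular e) {x : S} {t : ℝ≥0} (ht : t ∉ departures e x) :
    numDep e x (Iic t) = numDep e x (Iio t) := by
  rw [he.numDep_eq, he.numDep_eq]
  congr 2
  ext s
  simp only [mem_inter_iff, mem_Iic, mem_Iio, and_congr_right_iff]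
  exact fun hs => ⟨fun h => lt_of_le_of_ne h fun h' => ht (h' ▸ hs), le_of_lt⟩

theorem numArr_Iic (he : Regular e) {x : S} {t : ℝ≥0} (ht : t ∉ arrivals e x) :
    numArr e x (Iic t) = numArr e x (Iio t) := by
  rw [he.numArr_eq, he.numArr_eq]
  congr 2
  ext s
  simp only [mem_inter_iff, mem_Iic, mem_Iio, and_congr_right_iff]
  exact fun hs => ⟨fun h => lt_of_le_of_ne h fun h' => ht (h' ▸ hs), le_of_lt⟩

theorem numDep_mono (he : Regular e) (x : S) {A B : Set ℝ≥0} (h : A ⊆ B) :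
    numDep e x A ≤ numDep e x B := by
  rw [he.numDep_eq, he.numDep_eq]
  exact ENat.toENNReal_le.2 (encard_le_encard (inter_subset_inter_right _ h))

/-- Event times are countable, hence Lebesgue null: under a time integral the predictable counts
over `Iio t` replace those over `Iic t`. -/
theorem ae_notMem (he : Regular e) (x : S) :
    ∀ᵐ t ∂(volume.restrict (Ici (0 : ℝ))),
      t.toNNReal ∉ arrivals e x ∧ t.toNNReal ∉ departures e x := by
  set Z := arrivals e x ∪ departures e x ∪ e (.sleep x)
  have hZ : Z.Countable := by
    have : Z = ⋃ n : ℕ, Z ∩ Iic (n : ℝ≥0) := by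
      rw [← inter_iUnion, eq_comm, inter_eq_left]
      intro t _
      obtain ⟨n, hn⟩ := exists_nat_ge t
      exact mem_iUnion.2 ⟨n, hn⟩
    rw [this]
    exact countable_iUnion fun n => (he.finite x n).countable
  have h1 : ∀ᵐ t : ℝ, t ∉ (fun s : ℝ≥0 => (s : ℝ)) '' Z := (hZ.image _).ae_notMem _
  rw [ae_restrict_iff' measurableSet_Ici]
  filter_upwards [h1] with t ht h0
  have : t.toNNReal ∉ Z := fun h => ht ⟨_, h, Real.coe_toNNReal t h0⟩
  exact ⟨fun h => this (Or.inl (Or.inl h)), fun h => this (Or.inl (Or.inr h))⟩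

/-- Since falling asleep at `s` there were no arrivals, and departures only lower the number, so two
particles at `t` would mean two particles just before `s`. -/
theorem not_fellAsleep (he : Regular e) {η₀ : S → ℕ} {x : S}
    (hs : ∀ s ∈ e (.sleep x), ¬ 2 + numDep e x (Iio s) ≤ η₀ x + numArr e x (Iio s)) {t : ℝ≥0}
    (ht : 2 ≤ particles η₀ e x t) : ¬ FellAsleep e x t := by
  rintro ⟨s, hse, hst, hdis⟩
  have hsa : s ∉ arrivals e x := fun h => by
    obtain ⟨y, hy⟩ := mem_iUnion.1 h
    exact (he.disjoint (i := .hop y x) (j := .sleep x) (by simp)).ne_of_mem hy hse rfl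
  have hsd : s ∉ departures e x := fun h => by
    obtain ⟨y, hy⟩ := mem_iUnion.1 h
    exact (he.disjoint (i := .hop x y) (j := .sleep x) (by simp)).ne_of_mem hy hse rfl
  refine hs s hse ?_
  rw [← he.numDep_Iic hsd, ← he.numArr_Iic hsa]
  rw [he.two_le_particles_iff] at ht
  have h1 : numArr e x (Iic t) = numArr e x (Iic s) := by
    rw [he.numArr_eq, he.numArr_eq]
    congr 2
    ext u
    simp only [mem_inter_iff, mem_Iic, and_congr_right_iff]
    refine fun hu => ⟨fun h => ?_, fun h => h.trans hst⟩
    by_contra hlt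
    exact hdis.ne_of_mem hu ⟨not_le.1 hlt, h⟩ rfl
  rw [← h1]
  exact (add_le_add_right (he.numDep_mono x (Iic_subset_Iic.2 hst)) 2).trans ht

theorem one_le_activeParticles (he : Regular e) {η₀ : S → ℕ} {x : S}
    (hs : ∀ s ∈ e (.sleep x), ¬ 2 + numDep e x (Iio s) ≤ η₀ x + numArr e x (Iio s))
    (lam : ℝ≥0∞) {t : ℝ≥0} (ht : 2 ≤ particles η₀ e x t) :
    1 ≤ activeParticles η₀ lam e x t := by
  rw [activeParticles, if_neg]
  · omega
  · rintro (h | ⟨-, h⟩)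
    · exact he.not_fellAsleep hs ht h
    · omega

end Regular

variable {Ω : Type*} {m : MeasurableSpace Ω} {P : S → PMF S} {η₀ : S → ℕ}
  {lam : ℝ≥0∞} {μ : Measure Ω} {𝓕 : Filtration ℝ≥0 m} {ev : Event S → Ω → Set ℝ≥0}

theorem predictable_le_prod : 𝓕.predictable ≤ (inferInstance : MeasurableSpace (ℝ≥0 × Ω)) :=
  measurableSpace_le_predictable_of_measurableSet
    (fun _ hA => (measurableSet_singleton _).prod (𝓕.le _ _ hA))
    (fun _ _ hA => measurableSet_Ioi.prod (𝓕.le _ _ hA))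

variable [Countable S]

/-- Almost surely no particle falls asleep at a vertex with two particles. -/
theorem IsARW.ae_sleep (h : IsARW P η₀ lam μ 𝓕 ev) (x : S) :
    ∀ᵐ ω ∂μ, ∀ s ∈ ev (.sleep x) ω,
      ¬ 2 + numDep (ev · ω) x (Iio s) ≤ η₀ x + numArr (ev · ω) x (Iio s) := by
  classical
  set C : ℝ≥0 → Ω → ℝ≥0∞ := fun t ω =>
    if 2 + numDep (ev · ω) x (Iio t) ≤ η₀ x + numArr (ev · ω) x (Iio t) then 1 else 0
  have hC : Measurable[𝓕.predictable] (Function.uncurry C) := by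
    refine Measurable.ite ?_ measurable_const measurable_const
    exact @measurableSet_le _ _ _ _ _ 𝓕.predictable _ _ _ _ _
      ((measurable_numDep_Iio h.adapted x).const_add 2)
      ((measurable_numArr_Iio h.adapted x).const_add _)
  have hm : AEMeasurable (fun ω => ∑' t : ev (.sleep x) ω, C t ω) μ :=
    aemeasurable_tsum_of_predictable (h.adapted _)
      (h.ae_regular.mono fun _ he t => he.finite_sleep x t) hC
  -- With at least two particles at `x` the number of active ones is zero or at least two, never
  -- one, so the intensity of sleep vanishes.
  have h0 : ∫⁻ ω, ∑' t : ev (.sleep x) ω, C t ω ∂μ = 0 := by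
    rw [h.intensity _ C hC]
    refine lintegral_eq_zero_of_ae_eq_zero ?_
    filter_upwards [h.ae_regular] with ω he
    refine lintegral_eq_zero_of_ae_eq_zero ?_
    filter_upwards [he.ae_notMem x] with t ht
    by_cases hc : 2 + numDep (ev · ω) x (Iio t.toNNReal) ≤
        η₀ x + numArr (ev · ω) x (Iio t.toNNReal)
    · have h2 : 2 ≤ particles η₀ (ev · ω) x t.toNNReal := by
        rwa [he.two_le_particles_iff, he.numDep_Iic ht.2, he.numArr_Iic ht.1]
      have h3 : activeParticles η₀ lam (ev · ω) x t.toNNReal ≠ 1 := by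
        rw [activeParticles]
        split_ifs <;> omega
      simp [rate, h3]
    · simp [C, hc]
  rw [lintegral_eq_zero_iff' hm] at h0
  filter_upwards [h0] with ω hω s hs hc
  have := ENNReal.tsum_eq_zero.1 hω ⟨s, hs⟩
  simp [C, hc] at this

/-- Almost surely it does not happen that from some time on there are at least two particles at a
vertex, none of which hops. -/
theorem IsARW.ae_not_blocked [IsProbabilityMeasure μ] (h : IsARW P η₀ lam μ 𝓕 ev) (x : S)
    (i q : ℕ) :
    ∀ᵐ ω ∂μ, ¬ ∀ t : ℝ≥0, q < t →
      numDep (ev · ω) x (Iio t) = i ∧ (2 + i : ℝ≥0∞) ≤ η₀ x + numArr (ev · ω) x (Iio t) := by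
  classical
  -- `C` indicates the times after `q` at which hop `i` is next and at least two particles are
  -- present. At almost all of these some particle is active, so the expected time spent there is at
  -- most the expected number of hops numbered `i`, hence at most 1. Being blocked forever would
  -- make that time infinite.
  set R : ℝ≥0 → Ω → ℝ≥0∞ := fun t ω =>
    if (q : ℝ≥0) < t ∧ (2 + i : ℝ≥0∞) ≤ η₀ x + numArr (ev · ω) x (Iio t) then 1 else 0
  set C : ℝ≥0 → Ω → ℝ≥0∞ := fun t ω => atHop (ev · ω) x i (fun t => R t ω) t
  have hR : Measurable[𝓕.predictable] (Function.uncurry R) := by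
    refine Measurable.ite ?_ measurable_const measurable_const
    refine @MeasurableSet.inter _ 𝓕.predictable {p : ℝ≥0 × Ω | (q : ℝ≥0) < p.1}
      {p : ℝ≥0 × Ω | (2 + i : ℝ≥0∞) ≤ η₀ x + numArr (ev · p.2) x (Iio p.1)} ?_ ?_
    · have : {p : ℝ≥0 × Ω | (q : ℝ≥0) < p.1} = Ioi (q : ℝ≥0) ×ˢ univ := by
        ext p
        simp
      rw [this]
      exact measurableSet_predictable_Ioi_prod (@MeasurableSet.univ _ (𝓕 _))
    · exact ((measurable_numArr_Iio h.adapted x).const_add _) measurableSet_Ici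
  have hC : Measurable[𝓕.predictable] (Function.uncurry C) := measurable_atHop h.adapted x i hR
  have hle : activeIntegral η₀ lam μ ev x C ≤ 1 := by
    rw [← h.lintegral_tsum_tsum_hop _ hC]
    calc _ ≤ ∫⁻ _, 1 ∂μ := by
          refine lintegral_mono_ae ?_
          filter_upwards [h.ae_regular] with ω he
          rw [he.tsum_tsum_hop_atHop]
          simp only [R]
          split_ifs <;> simp
      _ = 1 := by simp
  set g : Ω → ℝ≥0∞ := fun ω => ∫⁻ t in Ici (0 : ℝ), C t.toNNReal ω
  have hg : Measurable g := by
    have h1 : Measurable (Function.uncurry C) := hC.mono predictable_le_prod le_rfl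
    have h2 : Measurable fun z : Ω × ℝ => C z.2.toNNReal z.1 :=
      h1.comp ((measurable_real_toNNReal.comp measurable_snd).prodMk measurable_fst)
    exact h2.lintegral_prod_right'
  have hgle : ∫⁻ ω, g ω ∂μ ≤ 1 := by
    refine le_trans (lintegral_mono_ae ?_) hle
    filter_upwards [h.ae_regular, h.ae_sleep x] with ω he hs
    refine lintegral_mono_ae ?_
    filter_upwards [he.ae_notMem x] with t ht
    by_cases hc : numDep (ev · ω) x (Iio t.toNNReal) = i ∧
        (2 + i : ℝ≥0∞) ≤ η₀ x + numArr (ev · ω) x (Iio t.toNNReal)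
    · have h2 : 2 ≤ particles η₀ (ev · ω) x t.toNNReal := by
        rw [he.two_le_particles_iff, he.numDep_Iic ht.2, he.numArr_Iic ht.1, hc.1]
        exact hc.2
      refine le_mul_of_one_le_right' ?_
      exact_mod_cast he.one_le_activeParticles hs lam h2
    · have : C t.toNNReal ω = 0 := by
        simp only [C, atHop, R]
        split_ifs with h1 h2
        · exact absurd ⟨h1, h2.2⟩ hc
        · rfl
        · rfl
      simp [this]
  filter_upwards [ae_lt_top hg (ne_top_of_le_ne_top ENNReal.one_ne_top hgle)] with ω hω hb
  refine hω.ne (top_unique ?_)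
  calc (⊤ : ℝ≥0∞) = ∫⁻ _ in Ioi (q : ℝ), 1 := by simp
    _ = ∫⁻ t in Ioi (q : ℝ), C t.toNNReal ω := by
        refine setLIntegral_congr_fun measurableSet_Ioi fun t ht => ?_
        have hq : (q : ℝ≥0) < t.toNNReal := by
          rw [Real.lt_toNNReal_iff_coe_lt]
          exact ht
        obtain ⟨h1, h2⟩ := hb _ hq
        simp [C, atHop, R, h1, h2, hq]
    _ ≤ g ω := lintegral_mono_set (Ioi_subset_Ici (by positivity))

end Blocked

/-! ### Runs of the MSIA -/

section Runs

variable {S : Type*} [LinearOrder S]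

theorem two_le_of_firstCrowded {occ : S →₀ ℕ} {v : S} (h : firstCrowded occ = some v) :
    2 ≤ occ v := by
  unfold firstCrowded at h
  split_ifs at h with hne
  have := Finset.min'_mem _ hne
  rw [Option.some.inj h] at this
  exact (Finset.mem_filter.1 this).2

theorem two_le_of_nextHopFrom {s : MSIAState S} {v : S} (h : nextHopFrom s = some v) :
    2 ≤ s.occ v := by
  unfold nextHopFrom at h
  split at h
  · split_ifs at h with h2
    · rwa [← Option.some.inj h]
    · exact two_le_of_firstCrowded h
  · exact two_le_of_firstCrowded h

/-- `s'` is a possible successor of the state `s`. -/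
def IsStep (s s' : MSIAState S) : Prop :=
  (∃ v y, nextHopFrom s = some v ∧
    s' = ⟨s.occ - Finsupp.single v 1 + Finsupp.single y 1, some y⟩) ∨
  (nextHopFrom s = none ∧ s' = ⟨s.occ, none⟩)

/-- The first `n` steps of `Z` are possible steps of the MSIA started from `γ₀`. -/
structure IsRun (γ₀ : S →₀ ℕ) (n : ℕ) (Z : ℕ → MSIAState S) : Prop where
  start : Z 0 = ⟨γ₀, none⟩
  step : ∀ m < n, IsStep (Z m) (Z (m + 1))

/-- The number of hops from `v` in the first `m` steps. -/
def hopsFrom (Z : ℕ → MSIAState S) (m : ℕ) (v : S) : ℕ :=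
  ((Finset.range m).filter fun j => nextHopFrom (Z j) = some v).card

/-- The number of hops to `v` in the first `m` steps. -/
def hopsTo (Z : ℕ → MSIAState S) (m : ℕ) (v : S) : ℕ :=
  ((Finset.range m).filter fun j => (Z (j + 1)).last = some v).card

theorem hopsFrom_succ (Z : ℕ → MSIAState S) (m : ℕ) (v : S) :
    hopsFrom Z (m + 1) v = hopsFrom Z m v + if nextHopFrom (Z m) = some v then 1 else 0 := by
  simp only [hopsFrom, Finset.card_filter, Finset.sum_range_succ]

theorem hopsTo_succ (Z : ℕ → MSIAState S) (m : ℕ) (v : S) :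
    hopsTo Z (m + 1) v = hopsTo Z m v + if (Z (m + 1)).last = some v then 1 else 0 := by
  simp only [hopsTo, Finset.card_filter, Finset.sum_range_succ]

theorem hopsFrom_congr {Z Z' : ℕ → MSIAState S} {m : ℕ} (h : ∀ j < m, Z j = Z' j) (v : S) :
    hopsFrom Z m v = hopsFrom Z' m v := by
  unfold hopsFrom
  congr 1
  refine Finset.filter_congr fun j hj => ?_
  rw [h j (Finset.mem_range.1 hj)]

theorem hopsFrom_lt {Z : ℕ → MSIAState S} {j m : ℕ} (hjm : j < m) {v : S}
    (h : nextHopFrom (Z j) = some v) : hopsFrom Z j v < hopsFrom Z m v := by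
  refine Finset.card_lt_card ?_
  rw [Finset.ssubset_iff_of_subset]
  · exact ⟨j, by simp [hjm, h], by simp⟩
  · intro i hi
    simp only [Finset.mem_filter, Finset.mem_range] at hi ⊢
    exact ⟨hi.1.trans hjm, hi.2⟩

theorem eq_of_hopsFrom_eq {Z : ℕ → MSIAState S} {i j : ℕ} {v : S}
    (hi : nextHopFrom (Z i) = some v) (hj : nextHopFrom (Z j) = some v)
    (h : hopsFrom Z i v = hopsFrom Z j v) : i = j := by
  rcases lt_trichotomy i j with hij | hij | hij
  · exact absurd h (hopsFrom_lt hij hi).ne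
  · exact hij
  · exact absurd h (hopsFrom_lt hij hj).ne'

theorem IsRun.occ_add_hopsFrom {γ₀ : S →₀ ℕ} {n : ℕ} {Z : ℕ → MSIAState S} (hZ : IsRun γ₀ n Z)
    {m : ℕ} (hm : m ≤ n) (w : S) : (Z m).occ w + hopsFrom Z m w = γ₀ w + hopsTo Z m w := by
  induction m with
  | zero => simp [hopsFrom, hopsTo, hZ.start]
  | succ m ih =>
    have ih := ih (Nat.le_of_succ_le hm)
    rw [hopsFrom_succ, hopsTo_succ]
    rcases hZ.step m hm with ⟨v, y, hv, hs⟩ | ⟨hv, hs⟩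
    · have h2 := two_le_of_nextHopFrom hv
      rw [hs, hv]
      simp only [Finsupp.coe_add, Finsupp.coe_tsub, Pi.add_apply, Pi.sub_apply,
        Finsupp.single_apply, Option.some.injEq]
      split_ifs with h <;> first | subst h; omega | omega
    · rw [hs, hv]
      simpa using ih

/-- Hop number `i` from `x` in the realization `e` goes to `y`. -/
def HopsTo (e : Event S → Set ℝ≥0) (x : S) (i : ℕ) (y : S) : Prop :=
  ∃ t ∈ e (.hop x y), IsHopTime e x i t

/-- The first `m` steps of `Z` use the hops in `e`. -/
def Follows (e : Event S → Set ℝ≥0) (Z : ℕ → MSIAState S) (m : ℕ) : Prop :=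
  ∀ j < m, ∀ v y, nextHopFrom (Z j) = some v → (Z (j + 1)).last = some y →
    HopsTo e v (hopsFrom Z j v) y

variable {e : Event S → Set ℝ≥0} {γ₀ : S →₀ ℕ} {n : ℕ} {Z Z' : ℕ → MSIAState S}

theorem IsRun.exists_source (hZ : IsRun γ₀ n Z) {j : ℕ} (hj : j < n) {y : S}
    (hy : (Z (j + 1)).last = some y) : ∃ v, nextHopFrom (Z j) = some v := by
  rcases hZ.step j hj with ⟨v, -, hv, -⟩ | ⟨-, hs⟩
  · exact ⟨v, hv⟩
  · rw [hs] at hy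
    simp at hy

/-- Different steps use different pairs of a vertex and a hop number, and different hops happen at
different times. -/
theorem IsRun.exists_arrivals (hZ : IsRun γ₀ n Z) (he : Regular e) {m : ℕ} (hm : m ≤ n)
    (hf : Follows e Z m) (w : S) :
    ∃ T : Finset ℝ≥0, (T : Set ℝ≥0) ⊆ arrivals e w ∧ T.card = hopsTo Z m w := by
  classical
  have h1 : ∀ j, ∃ t : ℝ≥0, j < m → (Z (j + 1)).last = some w → ∃ v,
      nextHopFrom (Z j) = some v ∧ t ∈ e (.hop v w) ∧ IsHopTime e v (hopsFrom Z j v) t := by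
    intro j
    by_cases h : j < m ∧ (Z (j + 1)).last = some w
    · obtain ⟨v, hv⟩ := hZ.exists_source (h.1.trans_le hm) h.2
      obtain ⟨t, ht, htt⟩ := hf j h.1 v w hv h.2
      exact ⟨t, fun _ _ => ⟨v, hv, ht, htt⟩⟩
    · exact ⟨0, fun h1 h2 => absurd ⟨h1, h2⟩ h⟩
  choose t ht using h1
  refine ⟨((Finset.range m).filter fun j => (Z (j + 1)).last = some w).image t, ?_, ?_⟩
  · intro s hs
    simp only [Finset.coe_image, Finset.coe_filter, Finset.mem_range, mem_image,
      mem_ofPred_eq] at hs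
    obtain ⟨j, ⟨hj, hjw⟩, rfl⟩ := hs
    obtain ⟨v, -, hv, -⟩ := ht j hj hjw
    exact mem_iUnion.2 ⟨v, hv⟩
  · rw [Finset.card_image_of_injOn]
    · rfl
    · intro i hi j hj hij
      simp only [Finset.coe_filter, Finset.mem_range, mem_ofPred_eq] at hi hj
      obtain ⟨v, hv, hve, hvt⟩ := ht i hi.1 hi.2
      obtain ⟨u, hu, hue, hut⟩ := ht j hj.1 hj.2
      have hij : t i = t j := hij
      rw [hij] at hve hvt
      have huv : v = u := by
        by_contra hne
        exact (he.disjoint (i := .hop v w) (j := .hop u w) (by simpa using hne)).ne_of_mem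
          hve hue rfl
      subst huv
      refine eq_of_hopsFrom_eq hv hu ?_
      have := hvt.2.symm.trans hut.2
      exact_mod_cast this

/-- The least action principle: a run that is compatible with the hops of an ARW in which no vertex
is blocked uses only hops that happen. -/
theorem IsRun.follows (hZ : IsRun γ₀ n Z) (he : Regular e) {η₀ : S → ℕ} (hle : ∀ x, γ₀ x ≤ η₀ x)
    (hb : ∀ (x : S) (i q : ℕ), ¬ ∀ t : ℝ≥0, q < t →
      numDep e x (Iio t) = i ∧ (2 + i : ℝ≥0∞) ≤ η₀ x + numArr e x (Iio t))
    (hc : ∀ j < n, ∀ v y, nextHopFrom (Z j) = some v → (Z (j + 1)).last = some y →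
      numDep e v univ ≤ hopsFrom Z j v ∨ HopsTo e v (hopsFrom Z j v) y) :
    Follows e Z n := by
  suffices ∀ m ≤ n, Follows e Z m from this n le_rfl
  intro m
  induction m with
  | zero => exact fun _ j hj => absurd hj (Nat.not_lt_zero j)
  | succ m ih =>
    intro hm
    have ih := ih (Nat.le_of_succ_le hm)
    intro j hj v y hv hy
    rcases Nat.lt_succ_iff_lt_or_eq.1 hj with hj | rfl
    · exact ih j hj v y hv hy
    -- If the required hop never happens, at most `hopsFrom Z j v` particles ever leave `v`, whereas
    -- all earlier hops of the run to `v` do happen. As `v` holds at least two explorers in the run,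
    -- conservation leaves at least two particles there for good.
    refine (hc j hm v y hv hy).resolve_left fun hd => ?_
    obtain ⟨T, hT, hTc⟩ := hZ.exists_arrivals he (Nat.le_of_succ_le hm) ih v
    rw [he.numDep_eq, inter_univ] at hd
    have hd' : (departures e v).encard ≤ (hopsFrom Z j v : ℕ∞) := by exact_mod_cast hd
    have hfin : (departures e v).Finite := by
      rw [← encard_lt_top_iff]
      exact hd'.trans_lt (ENat.natCast_lt_top _)
    rw [← hfin.cast_ncard_eq] at hd'
    have hdn : (departures e v).ncard ≤ hopsFrom Z j v := by exact_mod_cast hd'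
    -- After `q` all departures from `v` and all arrivals in `T` have taken place.
    obtain ⟨b, hbd⟩ := (hfin.union T.finite_toSet).bddAbove
    obtain ⟨q, hq⟩ := exists_nat_ge b
    refine hb v (departures e v).ncard q fun t ht => ⟨?_, ?_⟩
    · rw [he.numDep_eq, inter_eq_left.2, ← hfin.cast_ncard_eq]
      · simp
      · exact fun s hs => ((hbd (Or.inl hs)).trans hq).trans_lt ht
    · have h1 : (T.card : ℝ≥0∞) ≤ numArr e v (Iio t) := by
        have : (T : Set ℝ≥0) ⊆ arrivals e v ∩ Iio t :=
          fun s hs => ⟨hT hs, ((hbd (Or.inr hs)).trans hq).trans_lt ht⟩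
        have h2 := encard_le_encard this
        rw [encard_coe_eq_coe_finsetCard] at h2
        rw [he.numArr_eq]
        exact_mod_cast ENat.toENNReal_le.2 h2
      have h2 := hZ.occ_add_hopsFrom (Nat.le_of_succ_le hm) v
      have h3 := two_le_of_nextHopFrom hv
      have h4 := hle v
      have h5 : 2 + (departures e v).ncard ≤ η₀ v + T.card := by omega
      calc (2 + ((departures e v).ncard : ℕ) : ℝ≥0∞) ≤ η₀ v + T.card := by exact_mod_cast h5
        _ ≤ _ := by gcongr

/-- The past determines the next source and the number of its hop, and `e` determines the target of
that hop. -/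
theorem IsRun.eq_of_follows (hZ : IsRun γ₀ n Z) (hZ' : IsRun γ₀ n Z') (he : Regular e)
    (hf : Follows e Z n) (hf' : Follows e Z' n) : ∀ m ≤ n, ∀ j ≤ m, Z j = Z' j := by
  intro m
  induction m with
  | zero =>
    intro _ j hj
    rw [Nat.le_zero.1 hj, hZ.start, hZ'.start]
  | succ m ih =>
    intro hm j hj
    have ih := ih (Nat.le_of_succ_le hm)
    rcases Nat.le_succ_iff.1 hj with hj | rfl
    · exact ih j hj
    have hmm := ih m le_rfl
    have hhf : ∀ v, hopsFrom Z m v = hopsFrom Z' m v := hopsFrom_congr fun j hj => ih j hj.le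
    rcases hZ.step m hm with ⟨v, y, hv, hs⟩ | ⟨hv, hs⟩
    · rcases hZ'.step m hm with ⟨v', y', hv', hs'⟩ | ⟨hv', hs'⟩
      · rw [← hmm, hv] at hv'
        obtain rfl := Option.some.inj hv'
        obtain ⟨t, ht, htt⟩ := hf m hm v y hv (by rw [hs])
        obtain ⟨t', ht', htt'⟩ := hf' m hm v y' (hmm ▸ hv) (by rw [hs'])
        rw [← hhf] at htt'
        obtain rfl := he.isHopTime_unique htt htt'
        have : y = y' := by
          by_contra hne
          exact (he.disjoint (i := .hop v y) (j := .hop v y') (by simpa using hne)).ne_of_mem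
            ht ht' rfl
        rw [hs, hs', hmm, this]
      · rw [← hmm, hv] at hv'
        simp at hv'
    · rcases hZ'.step m hm with ⟨v', y', hv', hs'⟩ | ⟨hv', hs'⟩
      · rw [← hmm, hv] at hv'
        simp at hv'
      · rw [hs, hs', hmm]

end Runs

/-! ### The law of the first steps of the MSIA -/

section Law

variable {S : Type*} [LinearOrder S]

/-- Since `last` records the target, different targets give different states and a single term
survives. -/
theorem msiaStep_apply_some (P : S → PMF S) {s : MSIAState S} {v : S}
    (hv : nextHopFrom s = some v) (y : S) :
    msiaStep P s ⟨s.occ - Finsupp.single v 1 + Finsupp.single y 1, some y⟩ = P v y := by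
  classical
  simp only [msiaStep, hv, PMF.map_apply]
  rw [tsum_eq_single y]
  · simp
  · intro z hz
    simp [hz.symm]

theorem isStep_of_msiaStep_ne_zero (P : S → PMF S) {s s' : MSIAState S}
    (h : msiaStep P s s' ≠ 0) : IsStep s s' := by
  rw [← PMF.mem_support_iff] at h
  unfold msiaStep at h
  split at h
  · rename_i v hv
    simp only [PMF.support_map, mem_image] at h
    obtain ⟨y, -, rfl⟩ := h
    exact Or.inl ⟨v, y, hv, rfl⟩
  · rename_i hv
    simp only [PMF.support_pure, mem_singleton_iff] at h
    exact Or.inr ⟨hv, h⟩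

/-- Steps after the end of the process have probability one and drop out; on the remaining ones the
default `x` is never used. -/
theorem IsRun.prod_msiaStep (P : S → PMF S) {γ₀ : S →₀ ℕ} {n : ℕ} {Z : ℕ → MSIAState S}
    (hZ : IsRun γ₀ n Z) (x : S) :
    ∏ m ∈ Finset.range n, msiaStep P (Z m) (Z (m + 1)) =
      ∏ m ∈ (Finset.range n).filter (fun m => (nextHopFrom (Z m)).isSome),
        P ((nextHopFrom (Z m)).getD x) ((Z (m + 1)).last.getD x) := by
  rw [Finset.prod_filter]
  refine Finset.prod_congr rfl fun m hm => ?_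
  rcases hZ.step m (Finset.mem_range.1 hm) with ⟨v, y, hv, hs⟩ | ⟨hv, hs⟩
  · rw [hs, msiaStep_apply_some P hv]
    simp [hv]
  · rw [hs]
    simp [msiaStep, hv]

theorem trajMeasure_dirac {X : ℕ → Type*} [∀ n, MeasurableSpace (X n)] (a : X 0)
    (κ : (n : ℕ) → Kernel ((i : Finset.Iic n) → X i) (X (n + 1))) [∀ n, IsMarkovKernel (κ n)] :
    Kernel.trajMeasure (Measure.dirac a) κ =
      Kernel.traj κ 0 ((MeasurableEquiv.piUnique fun i : Finset.Iic 0 => X i).symm a) := by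
  rw [Kernel.trajMeasure]
  refine (congrArg (fun ν => Measure.bind ν (Kernel.traj κ 0))
    (Measure.map_dirac' (MeasurableEquiv.measurable _) _)).trans ?_
  exact Measure.dirac_bind (Kernel.measurable _) _

/-- The joint law of the prefix and the next state is the composition product with the step kernel,
so each step contributes one factor. -/
theorem msiaLaw_prefix [Countable S] (P : S → PMF S) (γ₀ : S →₀ ℕ) (Z : ℕ → MSIAState S) (n : ℕ) :
    msiaLaw P γ₀ {Y | ∀ j ≤ n, Y j = Z j} =
      (Measure.dirac (⟨γ₀, none⟩ : MSIAState S)) {Z 0} *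
        ∏ m ∈ Finset.range n, msiaStep P (Z m) (Z (m + 1)) := by
  induction n with
  | zero =>
    simp only [Nat.le_zero, forall_eq, Finset.range_zero, Finset.prod_empty, mul_one]
    have hm : MeasurableSet {h : (i : Finset.Iic 0) → (fun _ : ℕ => MSIAState S) i |
        h ⟨0, Finset.mem_Iic.2 le_rfl⟩ = Z 0} :=
      (Set.to_countable _).measurableSet
    have h1 : {Y : ℕ → MSIAState S | Y 0 = Z 0} =
        Preorder.frestrictLe (π := fun _ => MSIAState S) 0 ⁻¹'
          {h | h ⟨0, Finset.mem_Iic.2 le_rfl⟩ = Z 0} := rfl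
    have h2 : msiaLaw P γ₀ = Kernel.traj (X := fun _ => MSIAState S) (msiaKernel P) 0
        ((MeasurableEquiv.piUnique _).symm ⟨γ₀, none⟩) := trajMeasure_dirac _ _
    rw [h2, h1,
      ← Measure.map_apply (Preorder.measurable_frestrictLe 0) hm,
      Kernel.traj_map_frestrictLe_apply, Kernel.partialTraj_self, Kernel.id_apply,
      Measure.dirac_apply' _ hm, Measure.dirac_apply' _ (measurableSet_singleton _)]
    rfl
  | succ n ih =>
    have hp : ∀ Y, Preorder.frestrictLe (π := fun _ => MSIAState S) n Y =
        Preorder.frestrictLe (π := fun _ => MSIAState S) n Z ↔ ∀ j ≤ n, Y j = Z j := by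
      intro Y
      rw [funext_iff]
      exact ⟨fun h j hj => h ⟨j, Finset.mem_Iic.2 hj⟩, fun h j => h j (Finset.mem_Iic.1 j.2)⟩
    have h0 : {Y : ℕ → MSIAState S | ∀ j ≤ n, Y j = Z j} =
        Preorder.frestrictLe (π := fun _ => MSIAState S) n ⁻¹'
          {Preorder.frestrictLe (π := fun _ => MSIAState S) n Z} := by
      ext Y
      exact (hp Y).symm
    have h1 : {Y : ℕ → MSIAState S | ∀ j ≤ n + 1, Y j = Z j} =
        (fun Y => (Preorder.frestrictLe (π := fun _ => MSIAState S) n Y, Y (n + 1))) ⁻¹'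
          ({Preorder.frestrictLe (π := fun _ => MSIAState S) n Z} ×ˢ {Z (n + 1)}) := by
      ext Y
      simp only [mem_ofPred_eq, mem_preimage, mem_prod, mem_singleton_iff, hp]
      constructor
      · exact fun h => ⟨fun j hj => h j (hj.trans (Nat.le_succ n)), h _ le_rfl⟩
      · rintro ⟨h, h'⟩ j hj
        rcases Nat.le_succ_iff.1 hj with hj | rfl
        · exact h j hj
        · exact h'
    rw [Finset.prod_range_succ, ← mul_assoc, ← ih, h0, h1, msiaLaw,
      ← Measure.map_apply (by fun_prop)
        ((measurableSet_singleton _).prod (measurableSet_singleton _)),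
      ← Measure.map_apply (by fun_prop) (measurableSet_singleton _),
      ← Kernel.map_frestrictLe_trajMeasure_compProd_eq_map_trajMeasure,
      Measure.compProd_apply_prod (measurableSet_singleton _) (measurableSet_singleton _),
      lintegral_singleton, mul_comm]
    congr 1
    exact PMF.toMeasure_apply_singleton _ _ (measurableSet_singleton _)

end Law

/-! ### Comparison of the visits -/

section Comparison

variable {S Ω : Type*} [LinearOrder S] {m : MeasurableSpace Ω} {P : S → PMF S}
  {γ₀ : S →₀ ℕ} {η₀ : S → ℕ} {lam : ℝ≥0∞} {μ : Measure Ω} {𝓕 : Filtration ℝ≥0 m}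
  {ev : Event S → Ω → Set ℝ≥0}

/-- The conditional probability, given the hops in `e`, that `Z` gives the first `n` steps of the
MSIA. The vertex `x` is a default value that does not matter. -/
def runWeight (P : S → PMF S) (x : S) (Z : ℕ → MSIAState S) (n : ℕ) (e : Event S → Set ℝ≥0) :
    ℝ≥0∞ :=
  ∏ m ∈ (Finset.range n).filter (fun m => (nextHopFrom (Z m)).isSome),
    hopFactor (P ((nextHopFrom (Z m)).getD x) ((Z (m + 1)).last.getD x)) e
      ((nextHopFrom (Z m)).getD x) ((Z (m + 1)).last.getD x)
      (hopsFrom Z m ((nextHopFrom (Z m)).getD x)) univ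

theorem runWeight_le_one (x : S) (Z : ℕ → MSIAState S) (n : ℕ) (e : Event S → Set ℝ≥0) :
    runWeight P x Z n e ≤ 1 :=
  Finset.prod_le_one' fun _ _ => hopFactor_le_one ((P _).coe_le_one _) _ _ _ _ _

theorem IsARW.lintegral_runWeight [Countable S] [IsProbabilityMeasure μ]
    (h : IsARW P η₀ lam μ 𝓕 ev) {n : ℕ} {Z : ℕ → MSIAState S} (hZ : IsRun γ₀ n Z) (x : S) :
    ∫⁻ ω, runWeight P x Z n (ev · ω) ∂μ = msiaLaw P γ₀ {Y | ∀ j ≤ n, Y j = Z j} := by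
  rw [msiaLaw_prefix, hZ.prod_msiaStep P x, hZ.start,
    Measure.dirac_apply' _ (measurableSet_singleton _)]
  simp only [indicator_of_mem (mem_singleton _), Pi.one_apply, one_mul]
  -- No hop is used twice: steps from the same vertex have different hop numbers.
  refine h.lintegral_prod_hopFactor _ _ _ _ fun a ha b hb hv hn => ?_
  obtain ⟨v, hva⟩ := Option.isSome_iff_exists.1 (Finset.mem_filter.1 ha).2
  obtain ⟨w, hwb⟩ := Option.isSome_iff_exists.1 (Finset.mem_filter.1 hb).2
  simp only [hva, hwb, Option.getD_some] at hv hn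
  subst hv
  exact eq_of_hopsFrom_eq hva hwb hn

/-- No factor vanishes, so each hop used is either unrevealed or goes where `Z` requires, which is
the compatibility assumed by `IsRun.follows`. -/
theorem IsRun.follows_of_runWeight_ne_zero {e : Event S → Set ℝ≥0} (he : Regular e)
    (hle : ∀ x, γ₀ x ≤ η₀ x)
    (hb : ∀ (x : S) (i q : ℕ), ¬ ∀ t : ℝ≥0, q < t →
      numDep e x (Iio t) = i ∧ (2 + i : ℝ≥0∞) ≤ η₀ x + numArr e x (Iio t))
    {n : ℕ} {Z : ℕ → MSIAState S} (hZ : IsRun γ₀ n Z) {x : S} (hW : runWeight P x Z n e ≠ 0) :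
    Follows e Z n := by
  refine hZ.follows he hle hb fun j hj v y hv hy => ?_
  have := Finset.prod_ne_zero_iff.1 hW j (by simp [hj, hv])
  rw [hv, hy, Option.getD_some, Option.getD_some, hopFactor] at this
  split_ifs at this with h1 h2
  · exact Or.inl h1
  · obtain ⟨t, -, h⟩ := (he.entered_iff isRatLower_univ).1 h2
    exact Or.inr ⟨t, h⟩
  · exact absurd rfl this

theorem measurable_runWeight [Countable S] (h : IsARW P η₀ lam μ 𝓕 ev) (x : S)
    (Z : ℕ → MSIAState S) (n : ℕ) :
    Measurable fun ω => runWeight P x Z n (ev · ω) :=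
  Finset.measurable_fun_prod _ fun _ _ => measurable_hopFactor_univ h.adapted _ _ _ _

/-- The initial state records no hop, so the states with indices `0` to `n` record exactly the hops
of the first `n` steps. -/
theorem IsRun.card_last_eq {n : ℕ} {Z : ℕ → MSIAState S} (hZ : IsRun γ₀ n Z) (x : S) :
    ((Finset.range (n + 1)).filter fun j => (Z j).last = some x).card = hopsTo Z n x := by
  rw [hopsTo, Finset.card_filter, Finset.card_filter, Finset.sum_range_succ', hZ.start]
  simp

/-- The trajectory that follows `h` up to time `n` and is constant afterwards. -/
def extendPrefix (n : ℕ) (h : Finset.Iic n → MSIAState S) (j : ℕ) : MSIAState S :=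
  h ⟨min j n, Finset.mem_Iic.2 (min_le_right _ _)⟩

theorem msiaLaw_card_le [Countable S] [IsProbabilityMeasure μ] (hARW : IsARW P η₀ lam μ 𝓕 ev)
    (hle : ∀ x, γ₀ x ≤ η₀ x) (x : S) (k n : ℕ) :
    msiaLaw P γ₀
        {Y | k ≤ ((Finset.range (n + 1)).filter fun j => (Y j).last = some x).card} ≤
      μ {ω | (k : ℕ∞) ≤ particleVisits (ev · ω) x} := by
  classical
  set good : (Finset.Iic n → MSIAState S) → Prop := fun h => IsRun γ₀ n (extendPrefix n h) ∧
    k ≤ ((Finset.range (n + 1)).filter fun j => (extendPrefix n h j).last = some x).card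
  set F : (Finset.Iic n → MSIAState S) → Ω → ℝ≥0∞ := fun h ω =>
    if good h then runWeight P x (extendPrefix n h) n (ev · ω) else 0
  have hF : ∀ h, Measurable (F h) := by
    intro h
    by_cases hh : good h
    · simpa only [F, if_pos hh] using measurable_runWeight hARW x _ n
    · simpa only [F, if_neg hh] using measurable_const
  have hcover : {Y : ℕ → MSIAState S |
        k ≤ ((Finset.range (n + 1)).filter fun j => (Y j).last = some x).card} ⊆
      ⋃ h, {Y | k ≤ ((Finset.range (n + 1)).filter fun j => (Y j).last = some x).card ∧
        ∀ j ≤ n, Y j = extendPrefix n h j} := by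
    intro Y hY
    refine mem_iUnion.2 ⟨fun j => Y j, hY, fun j hj => ?_⟩
    simp [extendPrefix, hj]
  -- Prefixes that are not runs have probability zero; those with too few hops to `x` give the empty
  -- event.
  have hterm : ∀ h, msiaLaw P γ₀
      {Y | k ≤ ((Finset.range (n + 1)).filter fun j => (Y j).last = some x).card ∧
        ∀ j ≤ n, Y j = extendPrefix n h j} ≤ ∫⁻ ω, F h ω ∂μ := by
    intro h
    by_cases hr : IsRun γ₀ n (extendPrefix n h)
    · by_cases hk : k ≤ ((Finset.range (n + 1)).filter
          fun j => (extendPrefix n h j).last = some x).card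
      · simp only [F, if_pos (show good h from ⟨hr, hk⟩)]
        rw [hARW.lintegral_runWeight hr]
        exact measure_mono fun Y hY => hY.2
      · refine (measure_mono_null (t := ∅) ?_ measure_empty).trans_le zero_le
        rintro Y ⟨hY, hYj⟩
        refine hk (hY.trans_eq ?_)
        congr 1
        refine Finset.filter_congr fun j hj => ?_
        rw [hYj j (Nat.lt_succ_iff.1 (Finset.mem_range.1 hj))]
    · refine le_of_eq_of_le ?_ zero_le
      refine measure_mono_null (t := {Y | ∀ j ≤ n, Y j = extendPrefix n h j}) (fun Y hY => hY.2) ?_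
      rw [msiaLaw_prefix]
      by_contra hne
      obtain ⟨h1, h2⟩ := mul_ne_zero_iff.1 hne
      refine hr ⟨?_, fun j hj => ?_⟩
      · by_contra h3
        refine h1 ?_
        rw [Measure.dirac_apply' _ (measurableSet_singleton _),
          indicator_of_notMem (fun h4 => h3 (mem_singleton_iff.1 h4).symm)]
      · exact isStep_of_msiaStep_ne_zero P (Finset.prod_ne_zero_iff.1 h2 j (Finset.mem_range.2 hj))
  have hb : ∀ᵐ ω ∂μ, ∀ (x : S) (i q : ℕ), ¬ ∀ t : ℝ≥0, q < t →
      numDep (ev · ω) x (Iio t) = i ∧ (2 + i : ℝ≥0∞) ≤ η₀ x + numArr (ev · ω) x (Iio t) :=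
    ae_all_iff.2 fun x => ae_all_iff.2 fun i => ae_all_iff.2 fun q => hARW.ae_not_blocked x i q
  -- At most one prefix has nonzero weight. Its weight is at most 1, and its hops to `x` yield `k`
  -- distinct arrivals.
  have hpoint : ∀ᵐ ω ∂μ, ∑' h, F h ω ≤
      {ω | (k : ℕ∞) ≤ particleVisits (ev · ω) x}.indicator (fun _ => (1 : ℝ≥0∞)) ω := by
    filter_upwards [hARW.ae_regular, hb] with ω he hbω
    by_cases hall : ∀ h, F h ω = 0
    · simp [hall]
    push Not at hall
    obtain ⟨h, hh⟩ := hall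
    have hprop : ∀ h, F h ω ≠ 0 → good h ∧ Follows (ev · ω) (extendPrefix n h) n := by
      intro h hh
      have hg : good h := by_contra fun hg => hh (if_neg hg)
      refine ⟨hg, hg.1.follows_of_runWeight_ne_zero he hle hbω (P := P) (x := x) ?_⟩
      simpa only [F, if_pos hg] using hh
    obtain ⟨hg, hf⟩ := hprop h hh
    rw [tsum_eq_single h]
    · rw [indicator_of_mem]
      · simp only [F, if_pos hg]
        exact runWeight_le_one _ _ _ _
      · obtain ⟨T, hT, hTc⟩ := hg.1.exists_arrivals he le_rfl hf x
        have h1 := hg.2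
        rw [hg.1.card_last_eq, ← hTc] at h1
        have h2 := encard_le_encard hT
        rw [encard_coe_eq_coe_finsetCard] at h2
        exact le_trans (by exact_mod_cast h1) h2
    · intro h' hne
      by_contra hh'
      obtain ⟨hg', hf'⟩ := hprop h' hh'
      refine hne (funext fun j => ?_)
      have := hg'.1.eq_of_follows hg.1 he hf' hf n le_rfl j (Finset.mem_Iic.1 j.2)
      simpa [extendPrefix, Finset.mem_Iic.1 j.2] using this
  calc _ ≤ ∑' h, msiaLaw P γ₀
        {Y | k ≤ ((Finset.range (n + 1)).filter fun j => (Y j).last = some x).card ∧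
        ∀ j ≤ n, Y j = extendPrefix n h j} := (measure_mono hcover).trans (measure_iUnion_le _)
    _ ≤ ∑' h, ∫⁻ ω, F h ω ∂μ := ENNReal.tsum_le_tsum hterm
    _ = ∫⁻ ω, ∑' h, F h ω ∂μ := (lintegral_tsum fun h => (hF h).aemeasurable).symm
    _ ≤ ∫⁻ ω, {ω | (k : ℕ∞) ≤ particleVisits (ev · ω) x}.indicator (fun _ => (1 : ℝ≥0∞)) ω ∂μ :=
        lintegral_mono_ae hpoint
    _ ≤ _ := lintegral_indicator_one_le _

/-- `k` visits are already made in finitely many steps, so continuity from below applies. -/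
theorem msiaLaw_le [Countable S] [IsProbabilityMeasure μ] (hARW : IsARW P η₀ lam μ 𝓕 ev)
    (hle : ∀ x, γ₀ x ≤ η₀ x) (x : S) (k : ℕ) :
    msiaLaw P γ₀ {Y | (k : ℕ∞) ≤ explorerVisits Y x} ≤
      μ {ω | (k : ℕ∞) ≤ particleVisits (ev · ω) x} := by
  have hsub : {Y : ℕ → MSIAState S | (k : ℕ∞) ≤ explorerVisits Y x} ⊆
      ⋃ n : ℕ, {Y | k ≤ ((Finset.range (n + 1)).filter fun j => (Y j).last = some x).card} := by
    intro Y hY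
    obtain ⟨T, hT, hcard⟩ := exists_subset_encard_eq (mem_ofPred_eq ▸ hY : (k : ℕ∞) ≤ _)
    have hfin : T.Finite := by
      rw [← encard_lt_top_iff, hcard]
      exact ENat.natCast_lt_top _
    obtain ⟨n, hn⟩ := hfin.bddAbove
    refine mem_iUnion.2 ⟨n, ?_⟩
    have h1 : T ⊆ ((Finset.range (n + 1)).filter fun j => (Y j).last = some x : Finset ℕ) := by
      intro j hj
      have h2 : (Y j).last = some x := hT hj
      simp [h2, hn hj]
    have h2 := encard_le_encard h1
    rw [hcard, encard_coe_eq_coe_finsetCard] at h2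
    exact_mod_cast h2
  refine (measure_mono hsub).trans ?_
  rw [Monotone.measure_iUnion]
  · exact iSup_le fun n => msiaLaw_card_le hARW hle x k n
  · intro a b hab Y hY
    refine le_trans (mem_ofPred_eq ▸ hY : k ≤ _) (Finset.card_le_card ?_)
    exact Finset.filter_subset_filter _ (Finset.range_mono (Nat.succ_le_succ hab))

end Comparison

end ActivatedWalk

end

theorem mainTheorem3 {S Ω : Type*} [Countable S] [LinearOrder S] [MeasurableSpace Ω]
    (P : S → PMF S) (γ₀ : S →₀ ℕ) (η₀ : S → ℕ) (hle : ∀ x, γ₀ x ≤ η₀ x)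
    (lam : ℝ≥0∞) (hlam : 0 < lam)
    (μ : Measure Ω) [IsProbabilityMeasure μ] (𝓕 : Filtration ℝ≥0 ‹MeasurableSpace Ω›)
    (ev : ActivatedWalk.Event S → Ω → Set ℝ≥0)
    (hARW : ActivatedWalk.IsARW P η₀ lam μ 𝓕 ev) (r : ℕ) (x : S) :
    -- visits counted as hops to `x`
    (ActivatedWalk.msiaLaw P γ₀ {Y | (r : ℕ∞) ≤ ActivatedWalk.explorerVisits Y x} ≤
      μ {ω | (r : ℕ∞) ≤ ActivatedWalk.particleVisits (ev · ω) x}) ∧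
    -- visits counted as hops to `x` together with the initial occupants of `x`
    (ActivatedWalk.msiaLaw P γ₀ {Y | (r : ℕ∞) ≤ γ₀ x + ActivatedWalk.explorerVisits Y x} ≤
      μ {ω | (r : ℕ∞) ≤ η₀ x + ActivatedWalk.particleVisits (ev · ω) x}) := by
  -- Counting initial occupants lowers the threshold for hops to `r - γ₀ x`; if this truncates, both
  -- sides hold trivially.
  have key : ∀ V : ℕ∞, (r : ℕ∞) ≤ γ₀ x + V ↔ ((r - γ₀ x : ℕ) : ℕ∞) ≤ V := by
    intro V
    rw [ENat.natCast_sub, tsub_le_iff_left]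
  refine ⟨ActivatedWalk.msiaLaw_le hARW hle x r, ?_⟩
  simp_rw [key]
  refine (ActivatedWalk.msiaLaw_le hARW hle x (r - γ₀ x)).trans (measure_mono fun ω hω => ?_)
  refine ((key _).2 hω).trans ?_
  gcongr
  exact hle x
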